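/- Consider a class of threshold-allocation audit settings. A setting has agent types $(\mathbf{x},\mathbf{z})$ with known features $\mathbf{x}$ and self-reported features $\mathbf{z}$, a distribution of types with density (or mass function) $h\ge 0$, a real score function $f$ and a threshold $\theta$; an agent reporting $(\mathbf{x},\mathbf{z}')$ is allocated a resource if and only if $f(\mathbf{x},\mathbf{z}')\ge\theta$. Settings, feature vectors and numbers are given to algorithms as bit strings. Assume that whenever some $\mathbf{z}$ has $h(\mathbf{x},\mathbf{z})>0$, the minimum type of $\mathbf{x}$ exists, that is, $f(\mathbf{x},\cdot)$ attains its minimum over $\{\mathbf{z}: h(\mathbf{x},\mathbf{z})>0\}$ at some $\mathbf{z}^*$. A report $(\mathbf{x},\mathbf{z}')$ is a sure-lie if $h(\mathbf{x},\mathbf{z}')=0$, and it is suspicious if it is not a sure-lie and, with the types of the other agents drawn independently from the distribution and reported truthfully, an agent reporting $(\mathbf{x},\mathbf{z}')$ has a strictly higher chance of being allocated a resource (before auditing) than an agent reporting the minimum type $(\mathbf{x},\mathbf{z}^*)$. Given the reports $\mathcal{A}'=(\mathbf{a}_1',\dots,\mathbf{a}_n')$ of $n$ agents and a rational budget $B\ge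 0$, let $G(\mathcal{A}')$ be the set of agents with suspicious reports. The policy UNIFORM audits agent $i$ with probability $1$ if $\mathbf{a}_i'$ is a sure-lie, with probability $\min\big(B/|G(\mathcal{A}')|,\,1\big)$ if $i\in G(\mathcal{A}')$, and with probability $0$ otherwise. Suppose that, from the descriptions of a setting and of a report $(\mathbf{x},\mathbf{z}')$, one can decide in polynomial time whether $f(\mathbf{x},\mathbf{z}')\ge\theta$, whether $h(\mathbf{x},\mathbf{z}')>0$, and whether there is a $\mathbf{z}^*$ with $h(\mathbf{x},\mathbf{z}^*)>0$ and $f(\mathbf{x},\mathbf{z}^*)<\theta$ (the test for sure-truths: the report is a sure-truth when there is no such $\mathbf{z}^*$). Then UNIFORM can be computed in polynomial time: some polynomial-time Turing machine, given the description of a setting, the budget $B$ (in binary) and the $n$ reports, outputs the $n$ audit probabilities as fractions with numerators and denominators in binary. -/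

import Mathlib

open MeasureTheory Computability

/-- A threshold-allocation audit setting. An agent's type is a pair `(x, z)` of known features `x`
and self-reported features `z`. Types are drawn from a distribution with density (or mass function)
`h` with respect to a reference measure (counting measure when the features are discrete).
`f` is the score function and `θ` the allocation threshold. The maps `readX` and `readZ` tell which
feature vector, if any, a bit string describes; a type that no string describes cannot be written
down as an input of an algorithm, but it is still a possible type of an agent. -/
structure AuditSetting where
  X : Type
  Z : Type
  [measX : MeasurableSpace X]
  [measZ : MeasurableSpace Z]
  ref : Measure (X × Z)
  h : X × Z → ℝ
  h_measurable : Measurable h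
  h_nonneg : ∀ a, 0 ≤ h a
  prob : IsProbabilityMeasure (ref.withDensity fun a => ENNReal.ofReal (h a))
  f : X × Z → ℝ
  θ : ℝ
  readX : List Bool → Option X
  readZ : List Bool → Option Z

namespace AuditSetting

attribute [instance] AuditSetting.measX AuditSetting.measZ

variable (S : AuditSetting)

/-- Agent types, and reported types. -/
abbrev AgentType : Type := S.X × S.Z

/-- The distribution of agent types, with density `h`. -/
noncomputable def D : Measure S.AgentType :=
  S.ref.withDensity fun a => ENNReal.ofReal (S.h a)

/-- `(x, z)` is a minimum type of `x`: a minimiser of `f (x, ·)` over the types of positive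
density. -/
def IsMinimumType (x : S.X) (z : S.Z) : Prop :=
  0 < S.h (x, z) ∧ ∀ z', 0 < S.h (x, z') → S.f (x, z) ≤ S.f (x, z')

/-- Threshold allocation: whether agent `i` gets a resource when the reports are `A`. -/
noncomputable def alloc {n : ℕ} (A : Fin n → S.AgentType) (i : Fin n) : ℝ :=
  open Classical in if S.θ ≤ S.f (A i) then 1 else 0

/-- The chance that agent `i`, reporting `a`, is allocated a resource (barring auditing), the other
agents' types being drawn independently from `D` and reported truthfully. -/
noncomputable def allocChance {n : ℕ} (i : Fin n) (a : S.AgentType) : ℝ :=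
  ∫ A : {j : Fin n // j ≠ i} → S.AgentType,
    S.alloc (fun j => if hj : j = i then a else A ⟨j, hj⟩) i ∂(Measure.pi fun _ => S.D)

/-- A report is a sure-lie if it has zero density. -/
def IsSureLie (a : S.AgentType) : Prop := S.h a = 0

/-- A report of agent `i` is suspicious if it is not a sure-lie and the minimum type with the same
known features has a strictly lower chance of being allocated a resource. -/
def IsSuspicious {n : ℕ} (i : Fin n) (a : S.AgentType) : Prop :=
  ¬ S.IsSureLie a ∧ ∃ z, S.IsMinimumType a.1 z ∧ S.allocChance i (a.1, z) < S.allocChance i a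

/-- The set of agents whose reports are suspicious. -/
noncomputable def suspicious {n : ℕ} (A : Fin n → S.AgentType) : Finset (Fin n) :=
  open Classical in Finset.univ.filter fun i => S.IsSuspicious i (A i)

/-- The audit policy UNIFORM with budget `B`: the probability of auditing agent `i` when the reports
are `A`. -/
noncomputable def uniform (B : ℝ) {n : ℕ} (A : Fin n → S.AgentType) (i : Fin n) : ℝ :=
  open Classical in
  if S.IsSureLie (A i) then 1
  else if i ∈ S.suspicious A then min (B / (S.suspicious A).card) 1
  else 0

/-- The sure-truth test: some type of positive density with the same known features as the report
`a` scores below the threshold. A report at or above the threshold is guaranteed to be honest, or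
at least to bring no gain, when this fails. -/
def SomeTypeBelow (a : S.AgentType) : Prop :=
  ∃ z, 0 < S.h (a.1, z) ∧ S.f (a.1, z) < S.θ

/-- A written report: two bit strings that describe a known and a self-reported feature vector. -/
def Report : Type :=
  {w : List Bool × List Bool // (S.readX w.1).isSome ∧ (S.readZ w.2).isSome}

variable {S}

/-- The type that a written report describes. -/
def Report.type (r : S.Report) : S.AgentType :=
  ((S.readX r.1.1).get r.2.1, (S.readZ r.1.2).get r.2.2)

end AuditSetting

/-- `⟨u,v⟩` as a string over Mathlib's Turing machine alphabet. -/
def encodePair (w : List Bool × List Bool) : List Γ' :=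
  Γ'.bra :: (w.1.map Γ'.bit ++ Γ'.comma :: (w.2.map Γ'.bit ++ [Γ'.ket]))

/-- A fraction `a / b`, numerator and denominator in binary; it need not be in lowest terms. -/
def encodeFraction (q : ℕ × ℕ) : List Γ' :=
  encodePair (encodeNat q.1, encodeNat q.2)

/-- A finite list of fractions. -/
def encodeFractions (l : List (ℕ × ℕ)) : List Γ' :=
  l.flatMap encodeFraction

/-- A class of audit settings: a family of settings, each of them described by a bit string. -/
structure AuditClass where
  ι : Type
  desc : ι → List Bool
  setting : ι → AuditSetting

namespace AuditClass

variable (C : AuditClass)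

/-- A setting of the class together with one report. -/
def Query : Type := Σ p : C.ι, (C.setting p).Report

/-- The string that presents a setting and one report to an algorithm. -/
def encodeQuery (q : C.Query) : List Γ' :=
  (C.desc q.1).map Γ'.bit ++ Γ'.comma :: encodePair q.2.1

/-- An input of the audit problem: a setting of the class, a budget and the reports of `n`
agents. -/
structure Input where
  p : C.ι
  B : ℚ≥0
  n : ℕ
  report : Fin n → (C.setting p).Report

/-- The string that presents an input of the audit problem to an algorithm. -/
def encodeInput (I : C.Input) : List Γ' :=
  (C.desc I.p).map Γ'.bit ++
    Γ'.comma :: (encodeFraction (I.B.num, I.B.den) ++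
      (List.ofFn I.report).flatMap fun r => encodePair r.1)

/-- A property of reports can be decided by a Turing machine in time polynomial in the length of
the descriptions of the setting and of the report. -/
def PolyTimeDecidable (P : (S : AuditSetting) → S.AgentType → Prop) : Prop :=
  open Classical in
  Nonempty (Turing.TM2ComputableInPolyTime C.encodeQuery encodeBool
    fun q : C.Query => decide (P (C.setting q.1) q.2.type))

/-- A polynomial-time Turing machine computes the policy UNIFORM: from a setting, a budget and the
reports of `n` agents it outputs the `n` audit probabilities, as fractions. -/
def UniformPolyTimeComputable : Prop :=
  ∃ g : C.Input → List (ℕ × ℕ),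
    Nonempty (Turing.TM2ComputableInPolyTime C.encodeInput encodeFractions g) ∧
    ∀ I : C.Input, ∃ hn : (g I).length = I.n, ∀ i : Fin I.n,
      ((g I).get (i.cast hn.symm)).2 ≠ 0 ∧
      (((g I).get (i.cast hn.symm)).1 : ℝ) / (((g I).get (i.cast hn.symm)).2 : ℝ) =
        (C.setting I.p).uniform (I.B : ℝ) (fun j => (I.report j).type) i

end AuditClass

/-! Allocation is a threshold rule applied to each report separately, so the other agents' types do
not matter: before auditing, the chance of a resource is 1 or 0 according to whether the agent's own
score reaches `θ` (`allocChance_eq`). A report is therefore suspicious exactly when it has positive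
density, it scores at least `θ`, and the minimum type of its known features scores below `θ`. The
last condition holds iff some type of positive density with these features scores below `θ`, so no
minimiser has to be found and the three given tests decide suspicion (`isSuspicious_iff`).

Only arithmetic remains. For `B = num / den` and `k` suspicious reports, `min (B / k) 1` is `1 / 1`
if `den * k ≤ num`, and `num / (den * k)` otherwise. The product comes from adding `den` once per
suspicious report, so binary addition and comparison suffice. It is at most `k` digits longer than
`den`, and `k` is bounded by the input length.

The rest is an explicit machine. Fragments compose with additive step bounds (`Runs.andThen`,
`Runs.thenIf_true`, `Runs.repeatUntil_false`). The deciding machines run as subroutines on private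
stacks and states (`call_runs`). One pass over the reports stores verdicts and accumulates `den * k`
(`reportLoop_leads`); a second pass, over the verdicts, writes the fractions (`writeLoop_leads`).
`audit_leads` bounds the total time, and `probability_eq_uniform` identifies the output with
UNIFORM. -/

open Turing

/-! ### Program fragments for stack machines -/

namespace StackMachine

variable {K : Type} {Γ : K → Type} {σ : Type}

/-- Rename the labels of a statement and replace its halting points by the statement `q`. -/
def substHalt {Λ Λ' : Type} (g : Λ → Λ') (q : TM2.Stmt Γ Λ' σ) :
    TM2.Stmt Γ Λ σ → TM2.Stmt Γ Λ' σ
  | .push k f s => .push k f (substHalt g q s)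
  | .peek k f s => .peek k f (substHalt g q s)
  | .pop k f s => .pop k f (substHalt g q s)
  | .load f s => .load f (substHalt g q s)
  | .branch f s t => .branch f (substHalt g q s) (substHalt g q t)
  | .goto f => .goto fun v => g (f v)
  | .halt => q

variable [DecidableEq K]

/-- A statement is a finite tree whose leaves jump or halt. Substitution leaves the path through the
tree unchanged; at a halting leaf, execution falls through into `q` within the same step, so
sequencing costs no extra time. -/
theorem stepAux_substHalt {Λ Λ' : Type} (g : Λ → Λ') (q : TM2.Stmt Γ Λ' σ)
    (s : TM2.Stmt Γ Λ σ) (v : σ) (S : ∀ k, List (Γ k)) :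
    TM2.stepAux (substHalt g q s) v S =
      match TM2.stepAux s v S with
      | ⟨some l, v', S'⟩ => ⟨some (g l), v', S'⟩
      | ⟨none, v', S'⟩ => TM2.stepAux q v' S' := by
  induction s generalizing v S with
  | branch f s t hs ht =>
    simp only [substHalt, TM2.stepAux]
    cases f v
    · exact ht v S
    · exact hs v S
  | goto f => rfl
  | halt => rfl
  | _ => simp_all only [substHalt, TM2.stepAux]

/-- `StepsTo M n c d`: the machine `M` goes from `c` to `d` in exactly `n` steps. -/
def StepsTo {Λ : Type} (M : Λ → TM2.Stmt Γ Λ σ) : ℕ → TM2.Cfg Γ Λ σ → TM2.Cfg Γ Λ σ → Prop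
  | 0, c, d => c = d
  | n + 1, c, d => ∃ e, TM2.step M c = some e ∧ StepsTo M n e d

theorem StepsTo.trans {Λ : Type} {M : Λ → TM2.Stmt Γ Λ σ} {m n : ℕ} {c d e : TM2.Cfg Γ Λ σ}
    (h₁ : StepsTo M m c d) (h₂ : StepsTo M n d e) : StepsTo M (m + n) c e := by
  induction m generalizing c with
  | zero => cases h₁; simpa using h₂
  | succ m ih =>
    obtain ⟨c', hc, h⟩ := h₁
    rw [Nat.succ_add]
    exact ⟨c', hc, ih h⟩

/-- Connects the recursive relation, convenient for induction, with the iterated step function by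
which Mathlib counts the steps of an evaluation. -/
theorem stepsTo_iff_iterate {Λ : Type} {M : Λ → TM2.Stmt Γ Λ σ} {n : ℕ}
    {c d : TM2.Cfg Γ Λ σ} :
    StepsTo M n c d ↔ (flip bind (TM2.step M))^[n] (some c) = some d := by
  induction n generalizing c with
  | zero => simp [StepsTo]
  | succ n ih =>
    rw [Function.iterate_succ_apply]
    have hnone : ∀ n, (flip bind (TM2.step M))^[n] none = none := fun n => by
      induction n with
      | zero => rfl
      | succ n ih => rw [Function.iterate_succ_apply]; exact ih
    change (∃ e, TM2.step M c = some e ∧ StepsTo M n e d) ↔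
      (flip bind (TM2.step M))^[n] (TM2.step M c) = some d
    cases TM2.step M c with
    | none => exact ⟨fun ⟨_, h, _⟩ => (nomatch h), fun h => nomatch (hnone n).symm.trans h⟩
    | some e => simp [ih]

theorem StepsTo.substHalt {Λ Λ' : Type} {A : Λ → TM2.Stmt Γ Λ σ} {B : Λ' → TM2.Stmt Γ Λ' σ}
    {g : Λ → Λ'} {q : TM2.Stmt Γ Λ' σ} (hB : ∀ l, B (g l) = substHalt g q (A l))
    {n : ℕ} {l : Λ} {v v' : σ} {S S' : ∀ k, List (Γ k)}
    (h : StepsTo A n ⟨some l, v, S⟩ ⟨none, v', S'⟩) :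
    StepsTo B n ⟨some (g l), v, S⟩ (TM2.stepAux q v' S') := by
  induction n generalizing l v S with
  | zero => cases h
  | succ n ih =>
    obtain ⟨e, he, h⟩ := h
    refine ⟨_, rfl, ?_⟩
    rw [hB, stepAux_substHalt]
    simp only [TM2.step, Option.some.injEq] at he
    rw [he]
    obtain ⟨_ | l', w, T⟩ := e
    -- A halted configuration has no successor, so this step must have been the last one.
    · cases n with
      | zero => cases h; rfl
      | succ n => obtain ⟨e, he, -⟩ := h; cases he
    · exact ih h

/-- A program fragment: it starts at the label `entry` and is left by halting. -/
structure Fragment (Γ : K → Type) (σ : Type) where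
  Λ : Type
  [fin : Fintype Λ]
  entry : Λ
  code : Λ → TM2.Stmt Γ Λ σ

attribute [instance] Fragment.fin

namespace Fragment

/-- Started in state `v` with stacks `S`, the fragment is left in state `v'` with stacks `S'`
after at most `n` steps. -/
def Runs (F : Fragment Γ σ) (v : σ) (S : ∀ k, List (Γ k)) (v' : σ) (S' : ∀ k, List (Γ k))
    (n : ℕ) : Prop :=
  ∃ m ≤ n, StepsTo F.code m ⟨some F.entry, v, S⟩ ⟨none, v', S'⟩

theorem Runs.mono {F : Fragment Γ σ} {v v' : σ} {S S' : ∀ k, List (Γ k)} {m n : ℕ}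
    (h : F.Runs v S v' S' m) (hmn : m ≤ n) : F.Runs v S v' S' n :=
  let ⟨k, hk, hs⟩ := h
  ⟨k, hk.trans hmn, hs⟩

/-- One statement, which may jump back to itself. -/
def single (q : TM2.Stmt Γ Unit σ) : Fragment Γ σ where
  Λ := Unit
  entry := ()
  code _ := q

theorem single_halt {q : TM2.Stmt Γ Unit σ} {v v' : σ} {S S' : ∀ k, List (Γ k)}
    (h : TM2.stepAux q v S = ⟨none, v', S'⟩) : (single q).Runs v S v' S' 1 :=
  ⟨1, le_rfl, _, rfl, h⟩

theorem single_goto {q : TM2.Stmt Γ Unit σ} {v v' v'' : σ} {S S' S'' : ∀ k, List (Γ k)} {n : ℕ}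
    (h : TM2.stepAux q v S = ⟨some (), v', S'⟩) (hr : (single q).Runs v' S' v'' S'' n) :
    (single q).Runs v S v'' S'' (n + 1) :=
  let ⟨k, hk, hs⟩ := hr
  ⟨k + 1, Nat.succ_le_succ hk, _, congrArg some h, hs⟩

/-- Run `F` and then, if the test succeeds, `G`. -/
def thenIf (F : Fragment Γ σ) (t : σ → Bool) (G : Fragment Γ σ) : Fragment Γ σ where
  Λ := F.Λ ⊕ G.Λ
  entry := .inl F.entry
  code
    | .inl l => substHalt Sum.inl (.branch t (.goto fun _ => .inr G.entry) .halt) (F.code l)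
    | .inr l => substHalt Sum.inr .halt (G.code l)

theorem Runs.thenIf_true {F G : Fragment Γ σ} {t : σ → Bool} {v v' v'' : σ}
    {S S' S'' : ∀ k, List (Γ k)} {m n : ℕ} (h : F.Runs v S v' S' m) (ht : t v' = true)
    (h' : G.Runs v' S' v'' S'' n) : (F.thenIf t G).Runs v S v'' S'' (m + n) := by
  obtain ⟨a, ha, hs⟩ := h
  obtain ⟨b, hb, hs'⟩ := h'
  refine ⟨a + b, Nat.add_le_add ha hb, ?_⟩
  have h₁ := hs.substHalt (B := (F.thenIf t G).code) (g := Sum.inl) fun _ => rfl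
  have h₂ := hs'.substHalt (B := (F.thenIf t G).code) (g := Sum.inr) fun _ => rfl
  simp only [TM2.stepAux, ht, cond_true] at h₁ h₂
  exact h₁.trans h₂

theorem Runs.thenIf_false {F G : Fragment Γ σ} {t : σ → Bool} {v v' : σ}
    {S S' : ∀ k, List (Γ k)} {m : ℕ} (h : F.Runs v S v' S' m) (ht : t v' = false) :
    (F.thenIf t G).Runs v S v' S' m := by
  obtain ⟨a, ha, hs⟩ := h
  refine ⟨a, ha, ?_⟩
  have h₁ := hs.substHalt (B := (F.thenIf t G).code) (g := Sum.inl) fun _ => rfl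
  simp only [TM2.stepAux, ht, cond_false] at h₁
  exact h₁

/-- Run `F` and then `G`. -/
def andThen (F G : Fragment Γ σ) : Fragment Γ σ :=
  F.thenIf (fun _ => true) G

theorem Runs.andThen {F G : Fragment Γ σ} {v v' v'' : σ} {S S' S'' : ∀ k, List (Γ k)}
    {m n : ℕ} (hF : F.Runs v S v' S' m) (hG : G.Runs v' S' v'' S'' n) :
    (F.andThen G).Runs v S v'' S'' (m + n) :=
  hF.thenIf_true rfl hG

/-- Run `F` again and again until the test succeeds. -/
def repeatUntil (F : Fragment Γ σ) (t : σ → Bool) : Fragment Γ σ where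
  Λ := F.Λ
  entry := F.entry
  code l := substHalt id (.branch t .halt (.goto fun _ => F.entry)) (F.code l)

theorem Runs.repeatUntil_true {F : Fragment Γ σ} {t : σ → Bool} {v v' : σ}
    {S S' : ∀ k, List (Γ k)} {m : ℕ} (h : F.Runs v S v' S' m) (ht : t v' = true) :
    (F.repeatUntil t).Runs v S v' S' m := by
  obtain ⟨a, ha, hs⟩ := h
  refine ⟨a, ha, ?_⟩
  have h₁ := hs.substHalt (B := (F.repeatUntil t).code) (g := id) fun _ => rfl
  simp only [TM2.stepAux, ht, cond_true] at h₁
  exact h₁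

theorem Runs.repeatUntil_false {F : Fragment Γ σ} {t : σ → Bool} {v v' v'' : σ}
    {S S' S'' : ∀ k, List (Γ k)} {m n : ℕ} (h : F.Runs v S v' S' m) (ht : t v' = false)
    (h' : (F.repeatUntil t).Runs v' S' v'' S'' n) :
    (F.repeatUntil t).Runs v S v'' S'' (m + n) := by
  obtain ⟨a, ha, hs⟩ := h
  obtain ⟨b, hb, hs'⟩ := h'
  refine ⟨a + b, Nat.add_le_add ha hb, ?_⟩
  have h₁ := hs.substHalt (B := (F.repeatUntil t).code) (g := id) fun _ => rfl
  simp only [TM2.stepAux, ht, cond_false] at h₁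
  exact h₁.trans hs'

end Fragment

/-! ### Subroutines -/

section Call

variable {J L A R : Type} [DecidableEq J] {M : J → FinTM2}

/-- The stack alphabets of a program with own stacks `L` that calls the machines `M`. -/
@[reducible] def alphabet (L A : Type) (M : J → FinTM2) : (L ⊕ Σ j, (M j).K) → Type
  | .inl _ => A
  | .inr p => (M p.1).Γ p.2

/-- The states of a program with registers `R` that calls the machines `M`. -/
abbrev CallState (R : Type) (M : J → FinTM2) : Type := R × ∀ j, (M j).σ

/-- Registers `r`, with all machines `M` in their initial states. -/
def ready (M : J → FinTM2) (r : R) : CallState R M := (r, fun j => (M j).initialState)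

/-- The stacks of a program and of the machines it calls. -/
def join (own : L → List A) (sub : ∀ j k, List ((M j).Γ k)) : ∀ k, List (alphabet L A M k)
  | .inl l => own l
  | .inr p => sub p.1 p.2

/-- All stacks of all machines are empty. -/
def idle (M : J → FinTM2) : ∀ j k, List ((M j).Γ k) := fun _ _ => []

/-- All stacks of all machines are empty, but for the content `x` of stack `k` of machine `j`. -/
def only (M : J → FinTM2) (j : J) (k : (M j).K) (x : List ((M j).Γ k)) :
    ∀ j k, List ((M j).Γ k) :=
  Function.update (idle M) j (Function.update (fun _ => []) k x)

theorem join_only (own : L → List A) (j : J) (k : (M j).K) (x : List ((M j).Γ k)) :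
    join own (only M j k x) (.inr ⟨j, k⟩) = x := by
  simp [join, only]

variable [DecidableEq L]

theorem update_join_inl (own : L → List A) (sub : ∀ j k, List ((M j).Γ k)) (l : L) (x : List A) :
    Function.update (join own sub) (.inl l) x = join (Function.update own l x) sub := by
  funext k
  rcases k with k | p
  · by_cases h : k = l
    · subst h; simp [join]
    · simp [join, h]
  · simp [join]

theorem update_join_inr (own : L → List A) (sub : ∀ j k, List ((M j).Γ k)) (j : J) (k : (M j).K)
    (x : List ((M j).Γ k)) :
    Function.update (join own sub) (.inr ⟨j, k⟩) x =
      join own (Function.update sub j (Function.update (sub j) k x)) := by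
  funext i
  rcases i with i | ⟨j', k'⟩
  · simp [join]
  · by_cases hj : j' = j
    · subst hj
      by_cases hk : k' = k
      · subst hk; simp [join]
      · simp [join, hk]
    · simp [join, hj]

theorem update_join_only (own : L → List A) (j : J) (k : (M j).K) (x y : List ((M j).Γ k)) :
    Function.update (join own (only M j k x)) (.inr ⟨j, k⟩) y = join own (only M j k y) := by
  rw [update_join_inr]; simp [only]

theorem only_nil (j : J) (k : (M j).K) : only M j k [] = idle M := by
  funext j' k'
  by_cases hj : j' = j
  · subst hj
    by_cases hk : k' = k
    · subst hk; simp [only, idle]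
    · simp [only, idle]
  · simp [only, idle, hj]

theorem initList_stk (tm : FinTM2) (x : List (tm.Γ tm.k₀)) :
    (initList tm x).stk = Function.update (fun _ => []) tm.k₀ x := by
  funext k
  by_cases hk : k = tm.k₀
  · subst hk; simp [initList]
  · simp [initList, hk]

theorem haltList_stk (tm : FinTM2) (x : List (tm.Γ tm.k₁)) :
    (haltList tm x).stk = Function.update (fun _ => []) tm.k₁ x := by
  funext k
  by_cases hk : k = tm.k₁
  · subst hk; simp [haltList]
  · simp [haltList, hk]

/-- A statement of the machine `j` as a statement of a program that calls it. -/
def embed (L A R : Type) (M : J → FinTM2) (j : J) {Λ : Type} :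
    TM2.Stmt (M j).Γ Λ (M j).σ → TM2.Stmt (alphabet L A M) Λ (CallState R M)
  | .push k f s => .push (.inr ⟨j, k⟩) (fun v => f (v.2 j)) (embed L A R M j s)
  | .peek k f s => .peek (.inr ⟨j, k⟩) (fun v o => (v.1, Function.update v.2 j (f (v.2 j) o)))
      (embed L A R M j s)
  | .pop k f s => .pop (.inr ⟨j, k⟩) (fun v o => (v.1, Function.update v.2 j (f (v.2 j) o)))
      (embed L A R M j s)
  | .load f s => .load (fun v => (v.1, Function.update v.2 j (f (v.2 j)))) (embed L A R M j s)
  | .branch f s t => .branch (fun v => f (v.2 j)) (embed L A R M j s) (embed L A R M j t)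
  | .goto f => .goto fun v => f (v.2 j)
  | .halt => .halt

/-- A configuration of the machine `j` as part of one of a program that calls it. -/
def embedCfg (own : L → List A) (r : R) (w : ∀ j, (M j).σ) (sub : ∀ j k, List ((M j).Γ k)) (j : J)
    {Λ : Type} (c : TM2.Cfg (M j).Γ Λ (M j).σ) :
    TM2.Cfg (alphabet L A M) Λ (CallState R M) :=
  ⟨c.l, (r, Function.update w j c.var), join own (Function.update sub j c.stk)⟩

/-- Embedded statements touch only the stacks and the state component indexed by `j`; the caller's
data and the other machines are carried along unchanged. -/
theorem stepAux_embed (own : L → List A) (r : R) (w : ∀ j, (M j).σ)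
    (sub : ∀ j k, List ((M j).Γ k)) (j : J) {Λ : Type} (s : TM2.Stmt (M j).Γ Λ (M j).σ)
    (v : (M j).σ) (S : ∀ k, List ((M j).Γ k)) :
    TM2.stepAux (embed L A R M j s) (r, Function.update w j v)
        (join own (Function.update sub j S)) =
      embedCfg own r w sub j (TM2.stepAux s v S) := by
  induction s generalizing v S with
  | push k f s ih =>
    simp only [embed, TM2.stepAux, ← ih, update_join_inr]
    simp [join]
  | peek k f s ih =>
    simp only [embed, TM2.stepAux, ← ih]
    simp [join]
  | pop k f s ih =>
    simp only [embed, TM2.stepAux, ← ih, update_join_inr]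
    simp [join]
  | load f s ih =>
    simp only [embed, TM2.stepAux, ← ih]
    simp
  | branch f s t hs ht =>
    simp only [embed, TM2.stepAux, Function.update_self]
    cases f v
    · exact ht v S
    · exact hs v S
  | goto f => simp [embed, TM2.stepAux, embedCfg]
  | halt => rfl

/-- Run the machine `j` on its own stacks. -/
def call (L A R : Type) (M : J → FinTM2) (j : J) : Fragment (alphabet L A M) (CallState R M) where
  Λ := (M j).Λ
  fin := (M j).ΛFin
  entry := (M j).main
  code l := embed L A R M j ((M j).m l)

theorem StepsTo.embed (own : L → List A) (r : R) (w : ∀ j, (M j).σ)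
    (sub : ∀ j k, List ((M j).Γ k)) (j : J) {n : ℕ} {c d : (M j).Cfg}
    (h : StepsTo (M j).m n c d) :
    StepsTo (call L A R M j).code n (embedCfg own r w sub j c) (embedCfg own r w sub j d) := by
  induction n generalizing c with
  | zero => cases h; rfl
  | succ n ih =>
    obtain ⟨e, he, h⟩ := h
    refine ⟨_, ?_, ih h⟩
    obtain ⟨_ | l, v, S⟩ := c
    · cases he
    · simp only [TM2.step, Option.some.injEq] at he
      rw [← he]
      exact congrArg some (stepAux_embed own r w sub j ((M j).m l) v S)

/-- By Mathlib's convention a machine starts and ends in its initial state, with every stack empty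
except the input or output stack. A finished call thus leaves the machine ready to be called again.
-/
theorem call_runs (own : L → List A) (r : R) (j : J) {x : List ((M j).Γ (M j).k₀)}
    {y : List ((M j).Γ (M j).k₁)} {t : ℕ} (h : TM2OutputsInTime (M j) x (some y) t) :
    (call L A R M j).Runs (ready M r) (join own (only M j (M j).k₀ x))
      (ready M r) (join own (only M j (M j).k₁ y)) t := by
  refine ⟨h.steps, h.steps_le_m, ?_⟩
  have hs : StepsTo (M j).m h.steps (initList (M j) x) (haltList (M j) y) :=
    stepsTo_iff_iterate.2 h.evals_in_steps
  have := hs.embed own r (fun j => (M j).initialState) (idle M) j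
  simp only [embedCfg, initList_stk, haltList_stk] at this
  have h₁ : Function.update (fun j => (M j).initialState) j (initList (M j) x).var =
    fun j => (M j).initialState := Function.update_eq_self j _
  have h₂ : Function.update (fun j => (M j).initialState) j (haltList (M j) y).var =
    fun j => (M j).initialState := Function.update_eq_self j _
  rw [h₁, h₂] at this
  exact this

end Call

/-! ### Binary arithmetic -/

/-- Passing to `Nat.bits` makes binary recursion on natural numbers available for the correctness of
the arithmetic. -/
theorem encodeNat_eq_bits (n : ℕ) : encodeNat n = n.bits := by
  have key : ∀ p : PosNum, encodePosNum p = (p : ℕ).bits := fun p => by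
    induction p with
    | one => rfl
    | bit0 p ih =>
      have : ((PosNum.bit0 p : PosNum) : ℕ) = Nat.bit false p := by
        rw [PosNum.cast_bit0, Nat.bit_val]; simp; ring
      rw [this, Nat.bits_append_bit _ _ fun h => absurd h (PosNum.cast_pos (α := ℕ) p).ne', ← ih]
      rfl
    | bit1 p ih =>
      have : ((PosNum.bit1 p : PosNum) : ℕ) = Nat.bit true p := by
        rw [PosNum.cast_bit1, Nat.bit_val]; simp; ring
      rw [this, Nat.bits_append_bit _ _ fun _ => rfl, ← ih]
      rfl
  have : ((n : Num) : ℕ) = n := Num.to_of_nat n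
  conv_rhs => rw [← this]
  unfold encodeNat
  cases (n : Num) with
  | zero => rfl
  | pos p => exact key p

/-- Binary addition with a carry, least significant bits first. -/
def addBits : Bool → List Bool → List Bool → List Bool
  | false, [], [] => []
  | true, [], [] => [true]
  | c, x :: xs, [] => (x ^^ false ^^ c) :: addBits (Bool.atLeastTwo x false c) xs []
  | c, [], y :: ys => (false ^^ y ^^ c) :: addBits (Bool.atLeastTwo false y c) [] ys
  | c, x :: xs, y :: ys => (x ^^ y ^^ c) :: addBits (Bool.atLeastTwo x y c) xs ys

/-- Comparison of binary numbers, least significant bits first; `c` is the result if they are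
equal. -/
def geBits : Bool → List Bool → List Bool → Bool
  | c, [], [] => c
  | c, x :: xs, [] => geBits (if x = false then c else x) xs []
  | c, [], y :: ys => geBits (if false = y then c else false) [] ys
  | c, x :: xs, y :: ys => geBits (if x = y then c else x) xs ys

/-- Schoolbook addition, by binary recursion on both numbers. Each use of `Nat.bits_append_bit` also
demands that a leading digit be 1, so the sum is produced in canonical form, without superfluous
zeros. -/
theorem addBits_bits (c : Bool) (m n : ℕ) :
    addBits c m.bits n.bits = (m + n + c.toNat).bits := by
  have hz : ∀ (d : Bool) (n : ℕ), addBits d [] n.bits = (n + d.toNat).bits := fun d n => by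
    induction n using Nat.binaryRec' generalizing d with
    | zero => cases d <;> simp [addBits]
    | bit b n hb ih =>
      rw [Nat.bits_append_bit _ _ hb, addBits, ih, ← Nat.bits_append_bit]
      · congr 1
        simp only [Nat.bit_val]
        cases b <;> cases d <;> simp [Bool.atLeastTwo] <;> omega
      · revert hb; cases b <;> cases d <;> simp [Bool.atLeastTwo]
  have hz' : ∀ (d : Bool) (n : ℕ), addBits d n.bits [] = (n + d.toNat).bits := fun d n => by
    induction n using Nat.binaryRec' generalizing d with
    | zero => cases d <;> simp [addBits]
    | bit b n hb ih =>
      rw [Nat.bits_append_bit _ _ hb, addBits, ih, ← Nat.bits_append_bit]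
      · congr 1
        simp only [Nat.bit_val]
        cases b <;> cases d <;> simp [Bool.atLeastTwo] <;> omega
      · revert hb; cases b <;> cases d <;> simp [Bool.atLeastTwo]
  induction m using Nat.binaryRec' generalizing c n with
  | zero => simpa using hz c n
  | bit a m ha ih =>
    induction n using Nat.binaryRec' with
    | zero => simpa using hz' c (Nat.bit a m)
    | bit b n hb =>
      rw [Nat.bits_append_bit _ _ ha, Nat.bits_append_bit _ _ hb, addBits, ih,
        ← Nat.bits_append_bit]
      · congr 1
        simp only [Nat.bit_val]
        cases a <;> cases b <;> cases c <;> simp [Bool.atLeastTwo] <;> omega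
      · revert ha hb; cases a <;> cases b <;> cases c <;> simp [Bool.atLeastTwo] <;> omega

/-- Scanning upwards from the least significant digit, each unequal pair overrides the result so far
and each equal pair keeps it; a missing digit counts as zero. -/
theorem geBits_bits (c : Bool) (m n : ℕ) :
    geBits c m.bits n.bits = decide (n < m ∨ n = m ∧ c = true) := by
  have hz : ∀ (d : Bool) (n : ℕ), geBits d [] n.bits = decide (n = 0 ∧ d = true) := fun d n => by
    induction n using Nat.binaryRec' generalizing d with
    | zero => cases d <;> simp [geBits]
    | bit b n hb ih =>
      rw [Nat.bits_append_bit _ _ hb, geBits, ih]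
      simp only [Nat.bit_val]
      cases b <;> cases d <;> simp
  have hz' : ∀ (d : Bool) (n : ℕ), geBits d n.bits [] = decide (0 < n ∨ d = true) := fun d n => by
    induction n using Nat.binaryRec' generalizing d with
    | zero => cases d <;> simp [geBits]
    | bit b n hb ih =>
      rw [Nat.bits_append_bit _ _ hb, geBits, ih]
      simp only [Nat.bit_val]
      cases b <;> cases d <;> simp
  induction m using Nat.binaryRec' generalizing c n with
  | zero => simpa using hz c n
  | bit a m ha ih =>
    induction n using Nat.binaryRec' with
    | zero =>
      have := hz' c (Nat.bit a m)
      simp only [Nat.zero_bits, this, decide_eq_decide]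
      have : Nat.bit a m ≠ 0 := fun h => by
        rw [Nat.bit_eq_zero_iff] at h
        have := ha h.1
        simp_all
      omega
    | bit b n hb =>
      rw [Nat.bits_append_bit _ _ ha, Nat.bits_append_bit _ _ hb, geBits, ih, decide_eq_decide]
      simp only [Nat.bit_val]
      cases a <;> cases b <;> cases c <;> simp <;> omega

theorem addBits_encodeNat (m n : ℕ) :
    addBits false (encodeNat m) (encodeNat n) = encodeNat (m + n) := by
  simp [encodeNat_eq_bits, addBits_bits]

theorem geBits_encodeNat (m n : ℕ) :
    geBits true (encodeNat m) (encodeNat n) = decide (n ≤ m) := by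
  simp [encodeNat_eq_bits, geBits_bits, le_iff_lt_or_eq]

/-- The crude bound `k < 2 ^ k` gives at most `k` extra digits. This is enough because `k` will be
at most the number of reports. -/
theorem length_encodeNat_mul_le (m k : ℕ) :
    (encodeNat (m * k)).length ≤ (encodeNat m).length + k := by
  simp only [encodeNat_eq_bits, Nat.size_eq_bits_len]
  rw [Nat.size_le, pow_add]
  rcases Nat.eq_zero_or_pos k with rfl | hk
  · simp
  · exact Nat.mul_lt_mul_of_lt_of_le (Nat.lt_size_self m) (Nat.lt_two_pow_self).le (by positivity)

/-! ### Registers, stacks and basic loops of the audit program -/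

/-- The three tests that the audit program relies on. -/
inductive Test
  | score
  | dens
  | sure
  deriving DecidableEq

instance : Fintype Test := ⟨{.score, .dens, .sure}, fun t => by cases t <;> decide⟩

/-- The stacks of the audit program itself. -/
inductive Own
  | inp | desc | rep | num | den | acc | codes | out | tmp | tmp₂
  deriving DecidableEq

instance : Fintype Own :=
  ⟨{.inp, .desc, .rep, .num, .den, .acc, .codes, .out, .tmp, .tmp₂}, fun k => by
    cases k <;> decide⟩

/-- The contents of the stacks of the audit program. -/
structure Mem where
  inp : List Γ' := []
  desc : List Γ' := []
  rep : List Γ' := []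
  num : List Γ' := []
  den : List Γ' := []
  acc : List Γ' := []
  codes : List Γ' := []
  out : List Γ' := []
  tmp : List Γ' := []
  tmp₂ : List Γ' := []

namespace Mem

def get (m : Mem) : Own → List Γ'
  | .inp => m.inp
  | .desc => m.desc
  | .rep => m.rep
  | .num => m.num
  | .den => m.den
  | .acc => m.acc
  | .codes => m.codes
  | .out => m.out
  | .tmp => m.tmp
  | .tmp₂ => m.tmp₂

def set (m : Mem) (k : Own) (x : List Γ') : Mem :=
  match k with
  | .inp => { m with inp := x }
  | .desc => { m with desc := x }
  | .rep => { m with rep := x }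
  | .num => { m with num := x }
  | .den => { m with den := x }
  | .acc => { m with acc := x }
  | .codes => { m with codes := x }
  | .out => { m with out := x }
  | .tmp => { m with tmp := x }
  | .tmp₂ => { m with tmp₂ := x }

theorem update_get (m : Mem) (k : Own) (x : List Γ') :
    Function.update m.get k x = (m.set k x).get := by
  funext i
  cases k <;> cases i <;> rfl

@[simp] theorem get_set_self (m : Mem) (k : Own) (x : List Γ') : (m.set k x).get k = x := by
  cases k <;> rfl

theorem get_set_of_ne (m : Mem) {i k : Own} (h : i ≠ k) (x : List Γ') :
    (m.set k x).get i = m.get i := by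
  rw [← update_get, Function.update_of_ne h]

@[simp] theorem set_set_self (m : Mem) (k : Own) (x y : List Γ') :
    (m.set k x).set k y = m.set k y := by
  cases k <;> rfl

@[simp] theorem set_get_self (m : Mem) (k : Own) : m.set k (m.get k) = m := by
  cases k <;> rfl

theorem set_comm (m : Mem) {i k : Own} (h : i ≠ k) (x y : List Γ') :
    (m.set i x).set k y = (m.set k y).set i x := by
  cases i <;> cases k <;> first | rfl | exact absurd rfl h

end Mem

/-- The registers of the audit program. -/
structure Reg where
  a : Option Γ' := none
  b : Option Γ' := none
  c : Bool := false
  flag : Test → Bool := fun _ => false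
  deriving Fintype

/-- The bit that a popped symbol stands for; a missing or foreign symbol counts as zero. -/
def bitVal : Option Γ' → Bool
  | some (.bit b) => b
  | _ => false

variable (T : Test → TM2ComputableAux Γ' Bool)

/-- The machines that decide the three tests. -/
abbrev machines (t : Test) : FinTM2 := (T t).tm

/-- Programs on the stacks and registers above that may call the three machines. -/
abbrev Prog : Type 1 :=
  Fragment (alphabet Own Γ' (machines T)) (CallState Reg (machines T))

variable {T}

/-- `P` leads from registers `r` and stacks `m` to `r'` and `m'` in at most `n` steps, the stacks
of the machines being empty before and after. -/
def Leads (P : Prog T) (r : Reg) (m : Mem) (r' : Reg) (m' : Mem) (n : ℕ) : Prop :=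
  P.Runs (ready _ r) (join m.get (idle _)) (ready _ r') (join m'.get (idle _)) n

/-- Pop symbols from `src` and push them on `dst` until a symbol with `p`, which is dropped, or the
end. -/
def move (p : Γ' → Bool) (src dst : Own) : Prog T :=
  .single <| .pop (.inl src) (fun v o => ({ v.1 with a := o }, v.2)) <|
    .branch (fun v => v.1.a.elim true p) .halt <|
      .push (.inl dst) (fun v => v.1.a.getD default) <| .goto fun _ => ()

/-- The hypothesis `hrest` says that `rest` is empty or starts with the delimiter. What stopped the
loop stays in register `a`, so that later tests can tell a delimiter from the end of the stack. -/
theorem move_leads {p : Γ' → Bool} {src dst : Own} (hne : src ≠ dst) (r : Reg) (m : Mem)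
    {l rest : List Γ'} (hl : ∀ x ∈ l, p x = false) (hrest : rest.head?.elim true p = true)
    (hm : m.get src = l ++ rest) :
    Leads (T := T) (move p src dst) r m { r with a := rest.head? }
      ((m.set src rest.tail).set dst (l.reverse ++ m.get dst)) (l.length + 1) := by
  induction l generalizing r m with
  | nil =>
    refine Fragment.single_halt ?_
    rw [List.nil_append] at hm
    simp [join, update_join_inl, Mem.update_get, ready, hm, hrest, Mem.set_comm _ hne]
  | cons x l ih =>
    have := ih { r with a := some x } ((m.set src (l ++ rest)).set dst (x :: m.get dst))
      (fun y hy => hl y (List.mem_cons_of_mem _ hy)) (by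
        rw [Mem.get_set_of_ne _ hne, Mem.get_set_self])
    rw [Mem.set_comm (m.set src (l ++ rest)) hne.symm, Mem.set_set_self, Mem.set_set_self,
      Mem.get_set_self] at this
    rw [List.reverse_cons, List.append_assoc]
    refine Fragment.single_goto ?_ this
    simp [join, update_join_inl, Mem.update_get, ready, hm, hl x, Mem.get_set_of_ne _ hne.symm]

/-- Pour the stack `src` on `dst`. -/
def pour (src dst : Own) : Prog T := move (fun _ => false) src dst

theorem pour_leads {src dst : Own} (hne : src ≠ dst) (r : Reg) (m : Mem) :
    Leads (T := T) (pour src dst) r m { r with a := none }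
      ((m.set src []).set dst ((m.get src).reverse ++ m.get dst)) ((m.get src).length + 1) :=
  move_leads hne r m (rest := []) (by simp) rfl (by simp)

/-- Empty the stack `src`. -/
def clear (src : Own) : Prog T :=
  .single <| .pop (.inl src) (fun v o => ({ v.1 with a := o }, v.2)) <|
    .branch (fun v => v.1.a.isNone) .halt <| .goto fun _ => ()

theorem clear_leads (src : Own) (r : Reg) (m : Mem) :
    Leads (T := T) (clear src) r m { r with a := none } (m.set src [])
      ((m.get src).length + 1) := by
  generalize hl : m.get src = l
  induction l generalizing r m with
  | nil =>
    refine Fragment.single_halt ?_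
    simp [join, update_join_inl, Mem.update_get, ready, hl]
  | cons x l ih =>
    have := ih { r with a := some x } (m.set src l) (by simp)
    rw [Mem.set_set_self] at this
    refine Fragment.single_goto ?_ this
    simp [join, update_join_inl, Mem.update_get, ready, hl]

/-- Pour the stack `src` on both `d` and `e`. -/
def pourTwice (src d e : Own) : Prog T :=
  .single <| .pop (.inl src) (fun v o => ({ v.1 with a := o }, v.2)) <|
    .branch (fun v => v.1.a.isNone) .halt <|
      .push (.inl d) (fun v => v.1.a.getD default) <|
        .push (.inl e) (fun v => v.1.a.getD default) <| .goto fun _ => ()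

theorem pourTwice_leads {src d e : Own} (hd : src ≠ d) (he : src ≠ e) (hde : d ≠ e) (r : Reg)
    (m : Mem) :
    Leads (T := T) (pourTwice src d e) r m { r with a := none }
      (((m.set src []).set d ((m.get src).reverse ++ m.get d)).set e
        ((m.get src).reverse ++ m.get e)) ((m.get src).length + 1) := by
  generalize hl : m.get src = l
  induction l generalizing r m with
  | nil =>
    refine Fragment.single_halt ?_
    simp [join, update_join_inl, Mem.update_get, ready, hl, Mem.set_comm _ hd,
      Mem.set_comm _ he]
  | cons x l ih =>
    have := ih { r with a := some x }
      (((m.set src l).set d (x :: m.get d)).set e (x :: m.get e)) (by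
        rw [Mem.get_set_of_ne _ he, Mem.get_set_of_ne _ hd, Mem.get_set_self])
    rw [Mem.set_comm ((m.set src l).set d _) he.symm, Mem.set_comm (m.set src l) hd.symm,
      Mem.set_set_self, Mem.get_set_self, Mem.get_set_of_ne _ hde, Mem.get_set_self,
      Mem.set_comm _ hde.symm, Mem.set_set_self, Mem.set_set_self] at this
    rw [List.reverse_cons, List.append_assoc, List.append_assoc]
    refine Fragment.single_goto ?_ this
    simp [join, update_join_inl, Mem.update_get, ready, hl, Mem.get_set_of_ne _ hd.symm,
      Mem.get_set_of_ne _ he.symm, Mem.get_set_of_ne _ hde.symm]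

/-- Pour the stack `src` on `dst` and on the input stack of the machine `t`. -/
def feed (t : Test) (src dst : Own) : Prog T :=
  .single <| .pop (.inl src) (fun v o => ({ v.1 with a := o }, v.2)) <|
    .branch (fun v => v.1.a.isNone) .halt <|
      .push (.inl dst) (fun v => v.1.a.getD default) <|
        .push (.inr ⟨t, (machines T t).k₀⟩)
          (fun v => (T t).inputAlphabet.symm (v.1.a.getD default)) <| .goto fun _ => ()

/-- The second copy on `dst` makes it possible to restore `src` after the call, which consumes the
first. -/
theorem feed_runs (t : Test) {src dst : Own} (hne : src ≠ dst) (r : Reg) (m : Mem)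
    (x : List Γ') :
    (feed t src dst : Prog T).Runs (ready _ r)
      (join m.get (only _ t _ (x.map (T t).inputAlphabet.symm)))
      (ready _ { r with a := none })
      (join ((m.set src []).set dst ((m.get src).reverse ++ m.get dst)).get
        (only _ t _ (((m.get src).reverse ++ x).map (T t).inputAlphabet.symm)))
      ((m.get src).length + 1) := by
  generalize hl : m.get src = l
  induction l generalizing r m x with
  | nil =>
    refine Fragment.single_halt ?_
    simp [join, update_join_inl, Mem.update_get, ready, hl, Mem.set_comm _ hne]
  | cons y l ih =>
    have := ih { r with a := some y } ((m.set src l).set dst (y :: m.get dst)) (y :: x) (by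
      rw [Mem.get_set_of_ne _ hne, Mem.get_set_self])
    rw [Mem.set_comm (m.set src l) hne.symm, Mem.set_set_self, Mem.set_set_self,
      Mem.get_set_self] at this
    rw [List.reverse_cons, List.append_assoc, List.append_assoc]
    refine Fragment.single_goto ?_ this
    simp only [TM2.stepAux, update_join_inl, Mem.update_get, join_only, update_join_only]
    simp [join, ready, hl, Mem.get_set_of_ne _ hne.symm]

/-- Push a symbol on the input stack of the machine `t`. -/
def emit (t : Test) (s : Γ') : Prog T :=
  .single <| .push (.inr ⟨t, (machines T t).k₀⟩) (fun _ => (T t).inputAlphabet.symm s) .halt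

theorem emit_runs (t : Test) (s : Γ') (r : Reg) (m : Mem) (x : List Γ') :
    (emit t s : Prog T).Runs (ready _ r)
      (join m.get (only _ t _ (x.map (T t).inputAlphabet.symm))) (ready _ r)
      (join m.get (only _ t _ ((s :: x).map (T t).inputAlphabet.symm))) 1 := by
  refine Fragment.single_halt ?_
  simp only [TM2.stepAux, join_only, update_join_only, List.map_cons]

/-- Pop the answer of the machine `t`. -/
def answer (t : Test) : Prog T :=
  .single <| .pop (.inr ⟨t, (machines T t).k₁⟩) (fun v o =>
    ({ v.1 with flag := Function.update v.1.flag t ((o.map (T t).outputAlphabet).getD false) },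
      v.2)) .halt

theorem answer_runs (t : Test) (b : Bool) (r : Reg) (m : Mem) :
    (answer t : Prog T).Runs (ready _ r)
      (join m.get (only _ t _ ([b].map (T t).outputAlphabet.symm)))
      (ready _ { r with flag := Function.update r.flag t b }) (join m.get (idle _)) 1 := by
  refine Fragment.single_halt ?_
  simp only [TM2.stepAux, join_only, update_join_only]
  simp [only_nil, ready]

/-- Add the numbers on the stacks `acc` and `den`; the sum is left on `tmp`, and `den` on `tmp₂`,
upside down. -/
def addLoop : Prog T :=
  .single <| .pop (.inl .acc) (fun v o => ({ v.1 with a := o }, v.2)) <|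
    .pop (.inl .den) (fun v o => ({ v.1 with b := o }, v.2)) <|
      .branch (fun v => v.1.a.isNone && v.1.b.isNone)
        (.branch (fun v => v.1.c) (.push (.inl .tmp) (fun _ => .bit true) .halt) .halt) <|
        .push (.inl .tmp) (fun v => .bit (bitVal v.1.a ^^ bitVal v.1.b ^^ v.1.c)) <|
          .load (fun v =>
            ({ v.1 with c := Bool.atLeastTwo (bitVal v.1.a) (bitVal v.1.b) v.1.c }, v.2)) <|
          .branch (fun v => v.1.b.isSome)
            (.push (.inl .tmp₂) (fun v => v.1.b.getD default) (.goto fun _ => ()))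
            (.goto fun _ => ())

/-- The loop follows the recursion of `addBits`, one call per iteration. The final carry is left
unspecified since nothing depends on it. -/
theorem addLoop_leads (r : Reg) (m : Mem) (xs ys : List Bool) (hx : m.acc = xs.map Γ'.bit)
    (hy : m.den = ys.map Γ'.bit) :
    ∃ c, Leads (T := T) addLoop r m { r with a := none, b := none, c := c }
      { m with
        acc := []
        den := []
        tmp := ((addBits r.c xs ys).map Γ'.bit).reverse ++ m.tmp
        tmp₂ := m.den.reverse ++ m.tmp₂ } (xs.length + ys.length + 1) := by
  generalize hc : r.c = c
  induction c, xs, ys using addBits.induct generalizing r m with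
  | case1 | case2 =>
    refine ⟨r.c, (Fragment.single_halt ?_).mono (Nat.le_add_left 1 _)⟩
    simp [join, update_join_inl, Mem.update_get, Mem.get, Mem.set, ready, hx, hy, hc, addBits]
  | case3 c x xs ih =>
    obtain ⟨c', h⟩ := ih
      { r with a := some (.bit x), b := none, c := Bool.atLeastTwo x false c }
      { m with acc := xs.map .bit, tmp := .bit (x ^^ false ^^ c) :: m.tmp } rfl hy rfl
    simp only [addBits, hy, List.map_cons, List.reverse_cons, List.append_assoc] at h ⊢
    refine ⟨c', Fragment.Runs.mono (Fragment.single_goto ?_ h) (by simp)⟩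
    simp [join, update_join_inl, Mem.update_get, Mem.get, Mem.set, ready, hx, hy, hc, bitVal]
  | case4 c y ys ih =>
    obtain ⟨c', h⟩ := ih
      { r with a := none, b := some (.bit y), c := Bool.atLeastTwo false y c }
      { m with
        den := ys.map .bit, tmp := .bit (false ^^ y ^^ c) :: m.tmp, tmp₂ := .bit y :: m.tmp₂ }
      hx rfl rfl
    simp only [addBits, hy, List.map_cons, List.reverse_cons, List.append_assoc] at h ⊢
    refine ⟨c', Fragment.Runs.mono (Fragment.single_goto ?_ h) (by simp)⟩
    simp [join, update_join_inl, Mem.update_get, Mem.get, Mem.set, ready, hx, hy, hc, bitVal]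
  | case5 c x xs y ys ih =>
    obtain ⟨c', h⟩ := ih
      { r with a := some (.bit x), b := some (.bit y), c := Bool.atLeastTwo x y c }
      { m with
        acc := xs.map .bit
        den := ys.map .bit
        tmp := .bit (x ^^ y ^^ c) :: m.tmp
        tmp₂ := .bit y :: m.tmp₂ } rfl rfl rfl
    simp only [addBits, hy, List.map_cons, List.reverse_cons, List.append_assoc] at h ⊢
    refine ⟨c', Fragment.Runs.mono (Fragment.single_goto ?_ h) (by simp; omega)⟩
    simp [join, update_join_inl, Mem.update_get, Mem.get, Mem.set, ready, hx, hy, hc, bitVal]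

/-- Compare the numbers on the stacks `num` and `acc`, which are left upside down on `tmp` and
`tmp₂`. -/
def compareLoop : Prog T :=
  .single <| .pop (.inl .num) (fun v o => ({ v.1 with a := o }, v.2)) <|
    .pop (.inl .acc) (fun v o => ({ v.1 with b := o }, v.2)) <|
      .branch (fun v => v.1.a.isNone && v.1.b.isNone) .halt <|
        .load (fun v =>
          ({ v.1 with c := if bitVal v.1.a = bitVal v.1.b then v.1.c else bitVal v.1.a }, v.2)) <|
        .branch (fun v => v.1.a.isNone)
          (.push (.inl .tmp₂) (fun v => v.1.b.getD default) (.goto fun _ => ()))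
          (.push (.inl .tmp) (fun v => v.1.a.getD default) <|
            .branch (fun v => v.1.b.isNone) (.goto fun _ => ())
              (.push (.inl .tmp₂) (fun v => v.1.b.getD default) (.goto fun _ => ())))

theorem compareLoop_leads (r : Reg) (m : Mem) (xs ys : List Bool) (hx : m.num = xs.map Γ'.bit)
    (hy : m.acc = ys.map Γ'.bit) :
    Leads (T := T) compareLoop r m { r with a := none, b := none, c := geBits r.c xs ys }
      { m with
        num := []
        acc := []
        tmp := m.num.reverse ++ m.tmp
        tmp₂ := m.acc.reverse ++ m.tmp₂ } (xs.length + ys.length + 1) := by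
  generalize hc : r.c = c
  induction c, xs, ys using geBits.induct generalizing r m with
  | case1 =>
    refine Fragment.single_halt ?_
    simp [join, update_join_inl, Mem.update_get, Mem.get, Mem.set, ready, hx, hy, hc, geBits]
  | case2 c x xs ih =>
    have h := ih
      { r with a := some (.bit x), b := none, c := if x = false then c else x }
      { m with num := xs.map .bit, tmp := .bit x :: m.tmp } rfl hy rfl
    simp only [geBits, hx, hy, List.map_cons, List.reverse_cons, List.append_assoc] at h ⊢
    refine Fragment.Runs.mono (Fragment.single_goto ?_ h) (by simp)
    simp [join, update_join_inl, Mem.update_get, Mem.get, Mem.set, ready, hx, hy, hc, bitVal]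
    cases x <;> rfl
  | case3 c y ys ih =>
    have h := ih
      { r with a := none, b := some (.bit y), c := if false = y then c else false }
      { m with acc := ys.map .bit, tmp₂ := .bit y :: m.tmp₂ } hx rfl rfl
    simp only [geBits, hx, hy, List.map_cons, List.reverse_cons, List.append_assoc] at h ⊢
    refine Fragment.Runs.mono (Fragment.single_goto ?_ h) (by simp)
    simp [join, update_join_inl, Mem.update_get, Mem.get, Mem.set, ready, hx, hy, hc, bitVal]
  | case4 c x xs y ys ih =>
    have h := ih
      { r with a := some (.bit x), b := some (.bit y), c := if x = y then c else x }
      { m with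
        num := xs.map .bit
        acc := ys.map .bit
        tmp := .bit x :: m.tmp
        tmp₂ := .bit y :: m.tmp₂ } rfl rfl rfl
    simp only [geBits, hx, hy, List.map_cons, List.reverse_cons, List.append_assoc] at h ⊢
    refine Fragment.Runs.mono (Fragment.single_goto ?_ h) (by simp; omega)
    simp [join, update_join_inl, Mem.update_get, Mem.get, Mem.set, ready, hx, hy, hc, bitVal]
    cases x <;> cases y <;> rfl

variable {T : Test → TM2ComputableAux Γ' Bool}

/-! ### The audit program -/

theorem Leads.weaken {P : Prog T} {r r' : Reg} {m m' m'' : Mem} {n k : ℕ}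
    (h : Leads P r m r' m' n) (hm : m' = m'') (hn : n ≤ k) : Leads P r m r' m'' k := by
  subst hm
  exact Fragment.Runs.mono h hn

theorem Leads.andThen {P Q : Prog T} {r r' r'' : Reg} {m m' m'' : Mem} {n k : ℕ}
    (hP : Leads P r m r' m' n) (hQ : Leads Q r' m' r'' m'' k) :
    Leads (P.andThen Q) r m r'' m'' (n + k) :=
  Fragment.Runs.andThen hP hQ

/-- Run the machine `t` on the setting and the report at hand. -/
def ask (t : Test) : Prog T :=
  (emit t .ket).andThen <| (feed t .rep .tmp).andThen <| (emit t .bra).andThen <|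
    (emit t .comma).andThen <| (feed t .desc .tmp₂).andThen <|
      Fragment.andThen (call Own Γ' Reg (machines T) t) <| (answer t).andThen <|
        (pour .tmp .rep).andThen (pour .tmp₂ .desc)

/-- The query has to be pushed from its last symbol to its first. `rep` and `desc` are kept upside
down, so popping them delivers the symbols in that order; pouring the copies back restores both for
the next test. -/
theorem ask_leads (t : Test) (r : Reg) (m : Mem) (htmp : m.tmp = []) (htmp₂ : m.tmp₂ = [])
    {b : Bool} {τ : ℕ}
    (h : TM2OutputsInTime (machines T t)
      ((m.desc.reverse ++ Γ'.comma :: Γ'.bra :: (m.rep.reverse ++ [Γ'.ket])).map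
        (T t).inputAlphabet.symm) (some ([b].map (T t).outputAlphabet.symm)) τ) :
    Leads (T := T) (ask t) r m { r with a := none, flag := Function.update r.flag t b } m
      (2 * m.rep.length + 2 * m.desc.length + τ + 8) := by
  have h₁ := emit_runs (T := T) t .ket r m []
  have h₂ := feed_runs (T := T) t (src := .rep) (dst := .tmp) (by decide) r m [.ket]
  have h₃ := emit_runs (T := T) t .bra { r with a := none }
    { m with rep := [], tmp := m.rep.reverse } (m.rep.reverse ++ [.ket])
  have h₄ := emit_runs (T := T) t .comma { r with a := none }
    { m with rep := [], tmp := m.rep.reverse } (.bra :: (m.rep.reverse ++ [.ket]))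
  have h₅ := feed_runs (T := T) t (src := .desc) (dst := .tmp₂) (by decide) { r with a := none }
    { m with rep := [], tmp := m.rep.reverse } (.comma :: .bra :: (m.rep.reverse ++ [.ket]))
  have h₆ := call_runs (L := Own) (A := Γ')
    (Mem.get { m with rep := [], tmp := m.rep.reverse, desc := [], tmp₂ := m.desc.reverse })
    { r with a := none } t h
  have h₇ := answer_runs (T := T) t b { r with a := none }
    { m with rep := [], tmp := m.rep.reverse, desc := [], tmp₂ := m.desc.reverse }
  have h₈ := pour_leads (T := T) (src := .tmp) (dst := .rep) (by decide)
    { r with a := none, flag := Function.update r.flag t b }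
    { m with rep := [], tmp := m.rep.reverse, desc := [], tmp₂ := m.desc.reverse }
  have h₉ := pour_leads (T := T) (src := .tmp₂) (dst := .desc) (by decide)
    { r with a := none, flag := Function.update r.flag t b }
    { m with tmp := [], desc := [], tmp₂ := m.desc.reverse }
  rw [List.map_nil, only_nil] at h₁
  simp only [Mem.get, Mem.set, htmp, htmp₂, List.append_nil, List.reverse_reverse,
    List.length_reverse] at h₂ h₃ h₄ h₅ h₆ h₈ h₉
  have := h₁.andThen <| h₂.andThen <| h₃.andThen <| h₄.andThen <| h₅.andThen <|
    h₆.andThen <| h₇.andThen <| Fragment.Runs.andThen h₈ h₉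
  refine Leads.weaken this ?_ (by omega)
  cases m; cases htmp; cases htmp₂; rfl

/-- What the three tests say about a report: `ket` for a sure-lie, `comma` for a suspicious report,
`blank` otherwise. -/
def verdict (f : Test → Bool) : Γ' :=
  if f .dens = false then .ket else if f .score = true ∧ f .sure = true then .comma else .blank

/-- Reset the registers, with a symbol in register `a`. -/
def mark : Prog T := .single <| .load (fun v => ({ a := some .blank }, v.2)) .halt

theorem mark_leads (r : Reg) (m : Mem) :
    Leads (T := T) mark r m { a := some .blank } m 1 :=
  Fragment.single_halt rfl

/-- Push the verdict on the stack `codes`. -/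
def classify : Prog T :=
  .single <| .push (.inl .codes) (fun v => verdict v.1.flag) <|
    .load (fun v => ({ v.1 with c := false }, v.2)) .halt

theorem classify_leads (r : Reg) (m : Mem) :
    Leads (T := T) classify r m { r with c := false }
      { m with codes := verdict r.flag :: m.codes } 1 := by
  refine Fragment.single_halt ?_
  simp [join, update_join_inl, Mem.update_get, Mem.get, Mem.set, ready]

/-- The symbols of a number on a stack. -/
def digits (n : ℕ) : List Γ' := (encodeNat n).map Γ'.bit

/-- Add the number on the stack `den` to the one on the stack `acc`. -/
def addDen : Prog T :=
  addLoop.andThen <| (pour .tmp .acc).andThen (pour .tmp₂ .den)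

/-- `addLoop` leaves sum and summand upside down; one more pour puts the least significant digits
back on top. The hypothesis `hc` is the zero carry-in. -/
theorem addDen_leads (r : Reg) (m : Mem) (hc : r.c = false) (htmp : m.tmp = [])
    (htmp₂ : m.tmp₂ = []) {x y : ℕ} (hx : m.acc = digits x) (hy : m.den = digits y) :
    ∃ r', Leads (T := T) addDen r m r' { m with acc := digits (x + y) }
      ((digits x).length + 2 * (digits y).length + (digits (x + y)).length + 3) := by
  obtain ⟨c, h₁⟩ := addLoop_leads (T := T) r m _ _ hx hy
  have h₂ := pour_leads (T := T) (src := .tmp) (dst := .acc) (by decide)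
    { r with a := none, b := none, c := c }
    { m with
      acc := [], den := [], tmp := (digits (x + y)).reverse, tmp₂ := m.den.reverse }
  have h₃ := pour_leads (T := T) (src := .tmp₂) (dst := .den) (by decide)
    { r with a := none, b := none, c := c }
    { m with
      acc := digits (x + y), den := [], tmp := [], tmp₂ := m.den.reverse }
  simp only [Mem.get, Mem.set, List.append_nil, List.reverse_reverse,
    List.length_reverse] at h₂ h₃
  rw [hc, addBits_encodeNat, htmp, htmp₂, List.append_nil, List.append_nil] at h₁
  refine ⟨_, (h₁.andThen (h₂.andThen h₃)).weaken ?_ ?_⟩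
  · simp [htmp, htmp₂]
  · simp only [hy, digits, List.length_map]
    omega

/-- Deal with the next report, if there is one. -/
def reportStep : Prog T :=
  (move (· = .bra) .inp .rep).thenIf (fun v => v.1.a.isSome) <|
    (move (· = .ket) .inp .rep).andThen <| (ask .score).andThen <| (ask .dens).andThen <|
      (ask .sure).andThen <|
        (classify.thenIf (fun v => decide (verdict v.1.flag = .comma)) addDen).andThen <|
          (clear .rep).andThen mark

/-- On the setting `d` and the report `w`, the three machines give the answers `f` in time `τ`. -/
def Answers (T : Test → TM2ComputableAux Γ' Bool) (d : List Bool) (w : List Bool × List Bool)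
    (f : Test → Bool) (τ : ℕ) : Prop :=
  ∀ t, Nonempty (TM2OutputsInTime (machines T t)
    ((d.map Γ'.bit ++ .comma :: encodePair w).map (T t).inputAlphabet.symm)
    (some ([f t].map (T t).outputAlphabet.symm)) τ)

theorem bit_ne {x s : Γ'} {l : List Bool} (hs : ∀ b, Γ'.bit b ≠ s) (hx : x ∈ l.map Γ'.bit) :
    decide (x = s) = false := by
  obtain ⟨b, -, rfl⟩ := List.mem_map.1 hx
  exact decide_eq_false (hs b)

theorem reportStep_leads {d : List Bool} {w : List Bool × List Bool} {f : Test → Bool} {τ : ℕ}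
    (hf : Answers T d w f τ) (r : Reg) (num : List Γ') (den acc s : ℕ) (codes rest : List Γ')
    (hd : d.length ≤ s) (hw : (encodePair w).length ≤ s) (hden : (digits den).length ≤ s)
    (hacc : (digits acc).length ≤ s) (hacc' : (digits (acc + den)).length ≤ s) :
    Leads (T := T) reportStep r
      { inp := encodePair w ++ rest
        desc := (d.map Γ'.bit).reverse
        num := num
        den := digits den
        acc := digits acc
        codes := codes } { a := some .blank }
      { inp := rest
        desc := (d.map Γ'.bit).reverse
        num := num
        den := digits den
        acc := digits (acc + if verdict f = .comma then den else 0)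
        codes := verdict f :: codes } (18 * s + 3 * τ + 40) := by
  set body : List Γ' := w.1.map Γ'.bit ++ .comma :: w.2.map Γ'.bit with hbody
  have hpair : encodePair w = .bra :: (body ++ [.ket]) := by simp [encodePair, hbody]
  set desc := (d.map Γ'.bit).reverse with hdesc
  have hdl : desc.length ≤ s := by simpa [hdesc] using hd
  have hbl : body.length ≤ s := by rw [hpair] at hw; simp at hw; omega
  have h₁ := move_leads (T := T) (p := (· = .bra)) (src := .inp) (dst := .rep) (by decide) r
    { inp := encodePair w ++ rest, desc := desc, num := num, den := digits den,
      acc := digits acc, codes := codes } (l := []) (rest := encodePair w ++ rest)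
    (by simp) (by simp [hpair]) rfl
  have h₂ := move_leads (T := T) (p := (· = .ket)) (src := .inp) (dst := .rep) (by decide)
    { r with a := some .bra }
    { inp := body ++ .ket :: rest, desc := desc, num := num, den := digits den,
      acc := digits acc, codes := codes } (l := body) (rest := .ket :: rest)
    (by
      intro x hx
      rw [hbody, List.mem_append, List.mem_cons] at hx
      rcases hx with hx | rfl | hx
      · exact bit_ne (by simp) hx
      · rfl
      · exact bit_ne (by simp) hx) rfl rfl
  simp only [Mem.get, Mem.set, hpair, List.append_nil, List.reverse_nil, List.nil_append,
    List.cons_append, List.head?_cons, List.tail_cons, List.append_assoc] at h₁ h₂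
  have ha : ∀ t r, Leads (T := T) (ask t) r
      { inp := rest, desc := desc, rep := body.reverse, num := num, den := digits den,
        acc := digits acc, codes := codes }
      { r with a := none, flag := Function.update r.flag t (f t) }
      { inp := rest, desc := desc, rep := body.reverse, num := num, den := digits den,
        acc := digits acc, codes := codes } (4 * s + τ + 8) := fun t r => by
    obtain ⟨h⟩ := hf t
    refine (ask_leads t r _ rfl rfl (b := f t) (τ := τ) ?_).weaken rfl ?_
    · simpa [hdesc, hpair] using h
    · simp only [List.length_reverse]
      omega
  -- All three flags are overwritten, so results from the previous report cannot leak in.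
  have hflag : Function.update (Function.update (Function.update r.flag .score (f .score))
      .dens (f .dens)) .sure (f .sure) = f := by
    funext t
    cases t <;> simp
  have h₃ := classify_leads (T := T) { r with a := none, flag := f }
    { inp := rest, desc := desc, rep := body.reverse, num := num, den := digits den,
      acc := digits acc, codes := codes }
  have h₄ : ∃ r', Leads (T := T)
      (classify.thenIf (fun v => decide (verdict v.1.flag = .comma)) addDen)
      { r with a := none, flag := f }
      { inp := rest, desc := desc, rep := body.reverse, num := num, den := digits den,
        acc := digits acc, codes := codes } r'
      { inp := rest, desc := desc, rep := body.reverse, num := num, den := digits den,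
        acc := digits (acc + if verdict f = .comma then den else 0),
        codes := verdict f :: codes } (4 * s + 4) := by
    by_cases hv : verdict f = .comma
    · obtain ⟨r', h⟩ := addDen_leads (T := T) { r with a := none, flag := f, c := false }
        { inp := rest, desc := desc, rep := body.reverse, num := num, den := digits den,
          acc := digits acc, codes := verdict f :: codes } rfl rfl rfl rfl rfl
      refine ⟨r', ?_⟩
      rw [if_pos hv]
      exact Fragment.Runs.mono (h₃.thenIf_true (by simp [ready, hv]) h) (by omega)
    · refine ⟨{ r with a := none, flag := f, c := false }, ?_⟩
      rw [if_neg hv]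
      exact Fragment.Runs.mono (h₃.thenIf_false (by simp [ready, hv])) (by omega)
  obtain ⟨r', h₄⟩ := h₄
  have h₅ := clear_leads (T := T) .rep r'
    { inp := rest, desc := desc, rep := body.reverse, num := num, den := digits den,
      acc := digits (acc + if verdict f = .comma then den else 0), codes := verdict f :: codes }
  have h₆ := mark_leads (T := T) { r' with a := none }
    { inp := rest, desc := desc, num := num, den := digits den,
      acc := digits (acc + if verdict f = .comma then den else 0), codes := verdict f :: codes }
  have hall := (ha .score { r with a := some .ket }).andThen <| (ha .dens _).andThen <|
    (ha .sure _).andThen <| Leads.andThen (by simpa only [hflag] using h₄) (h₅.andThen h₆)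
  have hinp : encodePair w ++ rest = .bra :: (body ++ .ket :: rest) := by simp [hpair]
  rw [hinp]
  refine Fragment.Runs.mono (Fragment.Runs.thenIf_true h₁ rfl (h₂.andThen hall)) ?_
  simp only [Mem.get, List.length_reverse, List.length_nil]
  omega

/-! ### Counting the suspicious reports -/

variable {T : Test → TM2ComputableAux Γ' Bool}

/-- Deal with all reports. -/
def reportLoop : Prog T := reportStep.repeatUntil fun v => v.1.a.isNone

/-- The number of suspicious reports in a list of reports with their test results. -/
def countSuspicious (l : List ((List Bool × List Bool) × (Test → Bool))) : ℕ :=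
  l.countP fun x => decide (verdict x.2 = .comma)

/-- The invariant is that `acc` holds `den * k`, with `k` the number of suspicious reports met so
far. The size bound ranges over all `i ≤ k + l.length` so that it survives the induction whether or
not `k` grows. -/
theorem reportLoop_leads {d : List Bool} {τ : ℕ}
    (l : List ((List Bool × List Bool) × (Test → Bool))) (hl : ∀ x ∈ l, Answers T d x.1 x.2 τ)
    (num : List Γ') (den k s : ℕ) (codes : List Γ') (hd : d.length ≤ s)
    (hw : ∀ x ∈ l, (encodePair x.1).length ≤ s)
    (hacc : ∀ i ≤ k + l.length, (digits (den * i)).length ≤ s)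
    (hden : (digits den).length ≤ s) :
    Leads (T := T) reportLoop { a := some .blank }
      { inp := l.flatMap fun x => encodePair x.1
        desc := (d.map Γ'.bit).reverse
        num := num
        den := digits den
        acc := digits (den * k)
        codes := codes } {}
      { desc := (d.map Γ'.bit).reverse
        num := num
        den := digits den
        acc := digits (den * (k + countSuspicious l))
        codes := (l.map fun x => verdict x.2).reverse ++ codes }
      (l.length * (18 * s + 3 * τ + 40) + 1) := by
  induction l generalizing k codes with
  | nil =>
    -- On empty input the search for a bracket leaves `none` in register `a`, which skips the body
    -- and ends the loop.
    have h := move_leads (T := T) (p := (· = .bra)) (src := .inp) (dst := .rep) (by decide)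
      { a := some .blank }
      { desc := (d.map Γ'.bit).reverse, num := num, den := digits den, acc := digits (den * k),
        codes := codes } (l := []) (rest := []) (by simp) rfl rfl
    refine Fragment.Runs.mono (Fragment.Runs.repeatUntil_true (h.thenIf_false rfl) rfl) (by simp)
  | cons x l ih =>
    have h := reportStep_leads (T := T) (hl x List.mem_cons_self) { a := some .blank } num den
      (den * k) s codes (l.flatMap fun x => encodePair x.1) hd (hw x List.mem_cons_self) hden
      (hacc k (Nat.le_add_right _ _)) (hacc (k + 1) (by simp))
    have h' := ih (fun x hx => hl x (List.mem_cons_of_mem _ hx))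
      (k + if verdict x.2 = .comma then 1 else 0) (verdict x.2 :: codes)
      (fun x hx => hw x (List.mem_cons_of_mem _ hx))
      (fun i hi => hacc i (by
        rw [List.length_cons]
        split_ifs at hi <;> omega))
    have e₁ : den * (k + if verdict x.2 = .comma then 1 else 0) =
        den * k + if verdict x.2 = .comma then den else 0 := by
      split_ifs <;> ring
    have e₂ : k + (if verdict x.2 = .comma then 1 else 0) + countSuspicious l =
        k + countSuspicious (x :: l) := by
      simp only [countSuspicious, List.countP_cons, decide_eq_true_eq]
      omega
    rw [e₁, e₂] at h'
    rw [List.map_cons, List.reverse_cons, List.append_assoc]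
    refine Fragment.Runs.mono (Fragment.Runs.repeatUntil_false h rfl h') ?_
    rw [List.length_cons]
    ring_nf
    omega

/-! ### Parsing the input -/

/-- Split the input into the setting, the budget and the reports. -/
def prelude : Prog T :=
  (move (· = .comma) .inp .desc).andThen <| (move (· = .bra) .inp .tmp).andThen <|
    (move (· = .comma) .inp .tmp).andThen <| (pour .tmp .num).andThen <|
      (move (· = .ket) .inp .tmp).andThen <| (pour .tmp .den).andThen mark

theorem prelude_leads (d : List Bool) (num den : ℕ) (rest : List Γ') :
    Leads (T := T) prelude {}
      { inp := d.map Γ'.bit ++ Γ'.comma :: (encodeFraction (num, den) ++ rest) }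
      { a := some .blank }
      { inp := rest, desc := (d.map Γ'.bit).reverse, num := digits num, den := digits den }
      (d.length + 2 * (digits num).length + 2 * (digits den).length + 7) := by
  have h₁ := move_leads (T := T) (p := (· = .comma)) (src := .inp) (dst := .desc) (by decide) {}
    { inp := d.map Γ'.bit ++ Γ'.comma :: (encodeFraction (num, den) ++ rest) }
    (rest := .comma :: (encodeFraction (num, den) ++ rest)) (fun x hx => bit_ne (by simp) hx)
    rfl rfl
  have h₂ := move_leads (T := T) (p := (· = .bra)) (src := .inp) (dst := .tmp) (by decide)
    { a := some .comma }
    { inp := encodeFraction (num, den) ++ rest, desc := (d.map Γ'.bit).reverse }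
    (l := []) (rest := .bra :: (digits num ++ .comma :: (digits den ++ .ket :: rest)))
    (by simp) rfl (by simp [Mem.get, encodeFraction, encodePair, digits])
  have h₃ := move_leads (T := T) (p := (· = .comma)) (src := .inp) (dst := .tmp) (by decide)
    { a := some .bra }
    { inp := digits num ++ .comma :: (digits den ++ .ket :: rest),
      desc := (d.map Γ'.bit).reverse }
    (l := digits num) (rest := .comma :: (digits den ++ .ket :: rest))
    (fun x hx => bit_ne (by simp) hx) rfl rfl
  have h₄ := pour_leads (T := T) (src := .tmp) (dst := .num) (by decide) { a := some .comma }
    { inp := digits den ++ .ket :: rest, desc := (d.map Γ'.bit).reverse,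
      tmp := (digits num).reverse }
  have h₅ := move_leads (T := T) (p := (· = .ket)) (src := .inp) (dst := .tmp) (by decide) {}
    { inp := digits den ++ .ket :: rest, desc := (d.map Γ'.bit).reverse, num := digits num }
    (l := digits den) (rest := .ket :: rest) (fun x hx => bit_ne (by simp) hx) rfl rfl
  have h₆ := pour_leads (T := T) (src := .tmp) (dst := .den) (by decide) { a := some .ket }
    { inp := rest, desc := (d.map Γ'.bit).reverse, num := digits num,
      tmp := (digits den).reverse }
  have h₇ := mark_leads (T := T) {}
    { inp := rest, desc := (d.map Γ'.bit).reverse, num := digits num, den := digits den }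
  simp only [Mem.get, Mem.set, List.append_nil, List.reverse_reverse, List.length_reverse,
    List.head?_cons, List.tail_cons] at h₁ h₂ h₃ h₄ h₅ h₆
  refine (h₁.andThen <| h₂.andThen <| h₃.andThen <| h₄.andThen <| h₅.andThen <|
    h₆.andThen h₇).weaken rfl ?_
  simp only [List.length_map, List.length_nil]
  omega

/-! ### The audit probability of a suspicious report -/

/-- Compare the numbers on the stacks `num` and `acc` and leave the fraction `min (num / acc) 1`
upside down on `tmp` and `tmp₂`. -/
def compare : Prog T :=
  (Fragment.single <| .load (fun v => ({ v.1 with c := true }, v.2)) .halt).andThen <|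
    (compareLoop.thenIf (fun v => v.1.c) <| (clear .tmp).andThen <| (clear .tmp₂).andThen <|
      .single <| .push (.inl .tmp) (fun _ => .bit true) <|
        .push (.inl .tmp₂) (fun _ => .bit true) .halt).andThen mark

/-- A fraction equal to `min (num / acc) 1`. -/
def capped (num acc : ℕ) : ℕ × ℕ := if acc ≤ num then (1, 1) else (num, acc)

theorem digits_one : digits 1 = [.bit true] := rfl

/-- Comparing `num` with `acc` decides whether the cap at 1 applies, without division. Register `c`
starts as `true` so that equality counts as capped; in particular `acc = 0` gives `1 / 1`, never a
zero denominator. -/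
theorem compare_leads (m : Mem) (num acc : ℕ) (hnum : m.num = digits num)
    (hacc : m.acc = digits acc) (htmp : m.tmp = []) (htmp₂ : m.tmp₂ = []) :
    Leads (T := T) compare {} m { a := some .blank }
      { m with
        num := []
        acc := []
        tmp := (digits (capped num acc).1).reverse
        tmp₂ := (digits (capped num acc).2).reverse }
      (2 * (digits num).length + 2 * (digits acc).length + 6) := by
  have h₁ : Leads (T := T) (.single <| .load (fun v => ({ v.1 with c := true }, v.2)) .halt) {} m
      { c := true } m 1 := Fragment.single_halt rfl
  have h₂ := compareLoop_leads (T := T) { c := true } m _ _ hnum hacc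
  rw [geBits_encodeNat, htmp, htmp₂, hnum, hacc, List.append_nil, List.append_nil] at h₂
  by_cases h : acc ≤ num
  · have h₃ := clear_leads (T := T) .tmp { c := true }
      { m with num := [], acc := [], tmp := (digits num).reverse, tmp₂ := (digits acc).reverse }
    have h₄ := clear_leads (T := T) .tmp₂ { c := true }
      { m with num := [], acc := [], tmp := [], tmp₂ := (digits acc).reverse }
    have h₅ : Leads (T := T) (.single <| .push (.inl .tmp) (fun _ => .bit true) <|
        .push (.inl .tmp₂) (fun _ => .bit true) .halt) { c := true }
        { m with num := [], acc := [], tmp := [], tmp₂ := [] } { c := true }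
        { m with num := [], acc := [], tmp := [.bit true], tmp₂ := [.bit true] } 1 := by
      refine Fragment.single_halt ?_
      simp [join, update_join_inl, Mem.update_get, Mem.get, Mem.set, ready]
    have h₆ := mark_leads (T := T) { c := true }
      { m with num := [], acc := [], tmp := [.bit true], tmp₂ := [.bit true] }
    rw [decide_eq_true h] at h₂
    have := h₁.andThen <| Fragment.Runs.andThen
      (Fragment.Runs.thenIf_true (t := fun v => v.1.c) h₂ rfl (h₃.andThen <| h₄.andThen h₅)) h₆
    rw [capped, if_pos h, digits_one]
    refine Leads.weaken this rfl ?_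
    simp only [Mem.get, List.length_reverse]
    simp only [digits, List.length_map]
    omega
  · have h₆ := mark_leads (T := T) {}
      { m with num := [], acc := [], tmp := (digits num).reverse, tmp₂ := (digits acc).reverse }
    rw [decide_eq_false h] at h₂
    rw [capped, if_neg h]
    unfold compare
    refine Leads.weaken (h₁.andThen <| Fragment.Runs.andThen
      (Fragment.Runs.thenIf_false (t := fun v => v.1.c) h₂ rfl) h₆) rfl ?_
    simp only [digits, List.length_map]
    omega

/-! ### Writing the output -/

/-- The audit probability that belongs to a verdict, if suspicious reports have `q`. -/
def probability (q : ℕ × ℕ) (s : Γ') : ℕ × ℕ :=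
  if s = .ket then (1, 1) else if s = .comma then q else (0, 1)

/-- Pop a verdict and write the audit probability, if it is not that of a suspicious report. -/
def writeConst : Prog T :=
  .single <| .pop (.inl .codes) (fun v o => ({ v.1 with a := o }, v.2)) <|
    .branch (fun v => v.1.a.isNone) .halt <|
      .push (.inl .out) (fun _ => .ket) <| .branch (fun v => decide (v.1.a = some .comma)) .halt <|
        .push (.inl .out) (fun _ => .bit true) <| .push (.inl .out) (fun _ => .comma) <|
          .branch (fun v => decide (v.1.a = some .ket))
            (.push (.inl .out) (fun _ => .bit true) <| .push (.inl .out) (fun _ => .bra) .halt)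
            (.push (.inl .out) (fun _ => .bra) .halt)

/-- Push a symbol on the output stack. -/
def write (s : Γ') : Prog T := .single <| .push (.inl .out) (fun _ => s) .halt

theorem write_leads (s : Γ') (r : Reg) (m : Mem) :
    Leads (T := T) (write s) r m r { m with out := s :: m.out } 1 := by
  refine Fragment.single_halt ?_
  simp [join, update_join_inl, Mem.update_get, Mem.get, Mem.set, ready]

/-- Write the fraction that is upside down on `tmp` and `tmp₂`, preceded by its closing bracket. -/
def writeFraction : Prog T :=
  (pourTwice .tmp₂ .out .acc).andThen <| (write .comma).andThen <|
    (pourTwice .tmp .out .num).andThen <| (write .bra).andThen <|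
      (pour .acc .tmp₂).andThen <| (pour .num .tmp).andThen mark

/-- Write one audit probability. -/
def writeStep : Prog T :=
  writeConst.thenIf (fun v => decide (v.1.a = some .comma)) writeFraction

/-- Write all audit probabilities. -/
def writeLoop : Prog T := writeStep.repeatUntil fun v => v.1.a.isNone

/-- The output stack is built from its end, so the denominator is written before the numerator. The
empty stacks `acc` and `num` hold copies from which the fraction is restored for later reports. -/
theorem writeFraction_leads (q : ℕ × ℕ) (m : Mem) (r : Reg) (hnum : m.num = [])
    (hacc : m.acc = []) (htmp : m.tmp = (digits q.1).reverse)
    (htmp₂ : m.tmp₂ = (digits q.2).reverse) :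
    Leads (T := T) writeFraction r m { a := some .blank }
      { m with out := .bra :: (digits q.1 ++ .comma :: (digits q.2 ++ m.out)) }
      (2 * (digits q.1).length + 2 * (digits q.2).length + 7) := by
  have h₁ := pourTwice_leads (T := T) (src := .tmp₂) (d := .out) (e := .acc) (by decide)
    (by decide) (by decide) r m
  have h₂ := write_leads (T := T) .comma { r with a := none }
    { m with out := digits q.2 ++ m.out, acc := digits q.2, tmp₂ := [] }
  have h₃ := pourTwice_leads (T := T) (src := .tmp) (d := .out) (e := .num) (by decide)
    (by decide) (by decide) { r with a := none }
    { m with out := .comma :: (digits q.2 ++ m.out), acc := digits q.2, tmp₂ := [] }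
  have h₄ := write_leads (T := T) .bra { r with a := none }
    { m with
      out := digits q.1 ++ .comma :: (digits q.2 ++ m.out), num := digits q.1,
      acc := digits q.2, tmp := [], tmp₂ := [] }
  have h₅ := pour_leads (T := T) (src := .acc) (dst := .tmp₂) (by decide) { r with a := none }
    { m with
      out := .bra :: (digits q.1 ++ .comma :: (digits q.2 ++ m.out)), num := digits q.1,
      acc := digits q.2, tmp := [], tmp₂ := [] }
  have h₆ := pour_leads (T := T) (src := .num) (dst := .tmp) (by decide) { r with a := none }
    { m with
      out := .bra :: (digits q.1 ++ .comma :: (digits q.2 ++ m.out)), num := digits q.1,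
      acc := [], tmp := [], tmp₂ := (digits q.2).reverse }
  have h₇ := mark_leads (T := T) { r with a := none }
    { m with
      out := .bra :: (digits q.1 ++ .comma :: (digits q.2 ++ m.out)), num := [],
      acc := [], tmp := (digits q.1).reverse, tmp₂ := (digits q.2).reverse }
  simp only [Mem.get, Mem.set, List.append_nil, List.reverse_reverse, List.length_reverse, htmp,
    htmp₂, hnum, hacc] at h₁ h₂ h₃ h₄ h₅ h₆
  refine (h₁.andThen <| h₂.andThen <| h₃.andThen <| h₄.andThen <| h₅.andThen <|
    h₆.andThen h₇).weaken ?_ (by omega)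
  simp [hnum, hacc, htmp, htmp₂]

theorem writeStep_leads (q : ℕ × ℕ) (r : Reg) (desc den : List Γ') (c : Γ')
    (codes out : List Γ') :
    ∃ r', r'.a.isNone = false ∧ Leads (T := T) writeStep r
      { desc := desc
        den := den
        codes := c :: codes
        out := out
        tmp := (digits q.1).reverse
        tmp₂ := (digits q.2).reverse } r'
      { desc := desc
        den := den
        codes := codes
        out := encodeFraction (probability q c) ++ out
        tmp := (digits q.1).reverse
        tmp₂ := (digits q.2).reverse }
      (2 * (digits q.1).length + 2 * (digits q.2).length + 8) := by
  by_cases hc : c = .comma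
  · have h₁ : Leads (T := T) writeConst r
        { desc := desc, den := den, codes := c :: codes, out := out, tmp := (digits q.1).reverse,
          tmp₂ := (digits q.2).reverse } { r with a := some .comma }
        { desc := desc, den := den, codes := codes, out := .ket :: out,
          tmp := (digits q.1).reverse, tmp₂ := (digits q.2).reverse } 1 := by
      refine Fragment.single_halt ?_
      simp [join, update_join_inl, Mem.update_get, Mem.get, Mem.set, ready, hc]
    have h₂ := writeFraction_leads (T := T) q
      { desc := desc, den := den, codes := codes, out := .ket :: out,
        tmp := (digits q.1).reverse, tmp₂ := (digits q.2).reverse } { r with a := some .comma }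
      rfl rfl rfl rfl
    refine ⟨{ a := some .blank }, rfl,
      Leads.weaken (Fragment.Runs.thenIf_true h₁ (by simp [ready]) h₂) ?_ (by omega)⟩
    simp [probability, hc, encodeFraction, encodePair, digits]
  · refine ⟨{ r with a := some c }, rfl, Fragment.Runs.mono
      (Fragment.Runs.thenIf_false (Fragment.single_halt ?_) (by simp [ready, hc])) (by omega)⟩
    by_cases hk : c = .ket
    · simp [join, update_join_inl, Mem.update_get, Mem.get, Mem.set, ready, hk, probability,
        encodeFraction, encodePair]
      rfl
    -- Zero is encoded by the empty string, so nothing is written between bracket and comma.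
    · simp [join, update_join_inl, Mem.update_get, Mem.get, Mem.set, ready, hk, hc, probability,
        encodeFraction, encodePair]
      rfl

/-- Verdicts are popped last report first, and the output grows from its end; the two reversals
cancel, and the fractions appear in the order of the reports. -/
theorem writeLoop_leads (q : ℕ × ℕ) (r : Reg) (desc den codes out : List Γ') :
    ∃ r', Leads (T := T) writeLoop r
      { desc := desc
        den := den
        codes := codes
        out := out
        tmp := (digits q.1).reverse
        tmp₂ := (digits q.2).reverse } r'
      { desc := desc
        den := den
        out := encodeFractions (codes.reverse.map (probability q)) ++ out
        tmp := (digits q.1).reverse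
        tmp₂ := (digits q.2).reverse }
      (codes.length * (2 * (digits q.1).length + 2 * (digits q.2).length + 8) + 1) := by
  induction codes generalizing r out with
  | nil =>
    refine ⟨{ r with a := none }, Fragment.Runs.mono (Fragment.Runs.repeatUntil_true
      (Fragment.Runs.thenIf_false (Fragment.single_halt ?_) (by simp [ready])) rfl) (by simp)⟩
    simp [join, update_join_inl, Mem.update_get, Mem.get, Mem.set, ready, encodeFractions]
  | cons c codes ih =>
    obtain ⟨r₁, hr₁, h₁⟩ := writeStep_leads (T := T) q r desc den c codes out
    obtain ⟨r₂, h₂⟩ := ih r₁ (encodeFraction (probability q c) ++ out)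
    refine ⟨r₂, Leads.weaken (Fragment.Runs.repeatUntil_false h₁ hr₁ h₂) ?_ ?_⟩
    · simp [encodeFractions]
    · rw [List.length_cons]
      ring_nf
      omega

/-- Empty all stacks but the output stack, and reset the registers. -/
def cleanUp : Prog T :=
  (clear .desc).andThen <| (clear .den).andThen <| (clear .tmp).andThen <|
    (clear .tmp₂).andThen <| .single <| .load (fun v => ({}, v.2)) .halt

theorem cleanUp_leads (r : Reg) (desc den out tmp tmp₂ : List Γ') :
    Leads (T := T) cleanUp r
      { desc := desc, den := den, out := out, tmp := tmp, tmp₂ := tmp₂ } {} { out := out }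
      (desc.length + den.length + tmp.length + tmp₂.length + 5) := by
  have h₁ := clear_leads (T := T) .desc r
    { desc := desc, den := den, out := out, tmp := tmp, tmp₂ := tmp₂ }
  have h₂ := clear_leads (T := T) .den { r with a := none }
    { den := den, out := out, tmp := tmp, tmp₂ := tmp₂ }
  have h₃ := clear_leads (T := T) .tmp { r with a := none }
    { out := out, tmp := tmp, tmp₂ := tmp₂ }
  have h₄ := clear_leads (T := T) .tmp₂ { r with a := none } { out := out, tmp₂ := tmp₂ }
  have h₅ : Leads (T := T) (.single <| .load (fun v => ({}, v.2)) .halt) { r with a := none }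
    { out := out } {} { out := out } 1 := Fragment.single_halt rfl
  simp only [Mem.get, Mem.set] at h₁ h₂ h₃ h₄
  exact (h₁.andThen <| h₂.andThen <| h₃.andThen <| h₄.andThen h₅).weaken rfl (by omega)

/-- The audit program. -/
def audit : Prog T :=
  prelude.andThen <| reportLoop.andThen <| compare.andThen <| writeLoop.andThen cleanUp

/-- A single bound `s` on all strings involved keeps the time estimate uniform: the reading and
writing passes each contribute a multiple of the number of reports, the rest is linear in `s`. -/
theorem audit_leads {d : List Bool} {τ : ℕ}
    (l : List ((List Bool × List Bool) × (Test → Bool))) (hl : ∀ x ∈ l, Answers T d x.1 x.2 τ)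
    (num den s : ℕ) (hs : 1 ≤ s) (hd : d.length ≤ s)
    (hw : ∀ x ∈ l, (encodePair x.1).length ≤ s) (hnum : (digits num).length ≤ s)
    (hden : (digits den).length ≤ s) (hacc : ∀ i ≤ l.length, (digits (den * i)).length ≤ s) :
    Leads (T := T) audit {}
      { inp := d.map Γ'.bit ++ Γ'.comma :: (encodeFraction (num, den) ++
          l.flatMap fun x => encodePair x.1) } {}
      { out := encodeFractions (l.map fun x =>
          probability (capped num (den * countSuspicious l)) (verdict x.2)) }
      (l.length * (22 * s + 3 * τ + 48) + 18 * s + 20) := by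
  have hcount : countSuspicious l ≤ l.length := List.countP_le_length
  have h₁ := prelude_leads (T := T) d num den (l.flatMap fun x => encodePair x.1)
  have h₂ := reportLoop_leads (T := T) l hl (digits num) den 0 s [] hd hw
    (fun i hi => hacc i (by omega)) hden
  rw [Nat.zero_add, List.append_nil, Nat.mul_zero] at h₂
  have h₃ := compare_leads (T := T)
    { desc := (d.map Γ'.bit).reverse, num := digits num, den := digits den,
      acc := digits (den * countSuspicious l), codes := (l.map fun x => verdict x.2).reverse }
    num (den * countSuspicious l) rfl rfl rfl rfl
  set q := capped num (den * countSuspicious l) with hq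
  obtain ⟨r, h₄⟩ := writeLoop_leads (T := T) q { a := some .blank } (d.map Γ'.bit).reverse
    (digits den) (l.map fun x => verdict x.2).reverse []
  have h₅ := cleanUp_leads (T := T) r (d.map Γ'.bit).reverse (digits den)
    (encodeFractions ((l.map fun x => verdict x.2).map (probability q)))
    (digits q.1).reverse (digits q.2).reverse
  rw [List.reverse_reverse, List.append_nil] at h₄
  refine (h₁.andThen <| h₂.andThen <| h₃.andThen <| h₄.andThen h₅).weaken ?_ ?_
  · rw [List.map_map]
    rfl
  · have hk := hacc _ hcount
    -- The capped fraction is either `(1, 1)`, where `1 ≤ s` is needed, or consists of numbers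
    -- already bounded.
    have hq₁ : (digits q.1).length ≤ s ∧ (digits q.2).length ≤ s := by
      rw [hq, capped]
      split_ifs
      · simpa [digits_one] using hs
      · exact ⟨hnum, hk⟩
    have hmul : l.length * (2 * (digits q.1).length + 2 * (digits q.2).length + 8) ≤
        l.length * (4 * s + 8) := Nat.mul_le_mul_left _ (by omega)
    have hsplit : l.length * (22 * s + 3 * τ + 48) =
        l.length * (18 * s + 3 * τ + 40) + l.length * (4 * s + 8) := by ring
    simp only [List.length_reverse, List.length_map] at h₄ h₅ ⊢
    omega

end StackMachine

namespace AuditSetting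

/-! ### The policy UNIFORM in terms of the three tests -/

variable (S : AuditSetting)

instance : IsProbabilityMeasure S.D := S.prob

/-- The integrand depends only on the agent's own report, hence is constant, and the product measure
has total mass one. -/
theorem allocChance_eq {n : ℕ} (i : Fin n) (a : S.AgentType) :
    S.allocChance i a = open Classical in if S.θ ≤ S.f a then 1 else 0 := by
  simp [allocChance, alloc]

/-- Two 0-1 chances differ strictly only if the report is accepted and the minimum type is not. A
type of positive density below `θ` forces the minimum type below `θ`; its existence comes from
`hmin`. -/
theorem isSuspicious_iff {n : ℕ} (i : Fin n) (a : S.AgentType)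
    (hmin : ∀ x, (∃ z, 0 < S.h (x, z)) → ∃ z, S.IsMinimumType x z) :
    S.IsSuspicious i a ↔ 0 < S.h a ∧ S.θ ≤ S.f a ∧ S.SomeTypeBelow a := by
  classical
  have hpos : ¬ S.IsSureLie a ↔ 0 < S.h a := by
    rw [IsSureLie, (S.h_nonneg a).lt_iff_ne']
  have hlt : ∀ z, S.allocChance i (a.1, z) < S.allocChance i a ↔
      S.f (a.1, z) < S.θ ∧ S.θ ≤ S.f a := fun z => by
    rw [allocChance_eq, allocChance_eq]
    split_ifs with h₁ h₂ h₂ <;> simp [h₁, h₂, not_lt.2, lt_of_not_ge]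
  simp only [IsSuspicious, hpos, hlt, SomeTypeBelow]
  constructor
  · rintro ⟨h, z, hz, hzθ, ha⟩
    exact ⟨h, ha, z, hz.1, hzθ⟩
  · rintro ⟨h, ha, z, hz, hzθ⟩
    obtain ⟨z₀, hz₀⟩ := hmin a.1 ⟨z, hz⟩
    exact ⟨h, z₀, hz₀, (hz₀.2 z hz).trans_lt hzθ, ha⟩

end AuditSetting

/-! ### Verdicts and audit probabilities -/

namespace StackMachine

/-- The property of reports that a test checks. -/
def Test.Holds : Test → (S : AuditSetting) → S.AgentType → Prop
  | .score, S, a => S.θ ≤ S.f a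
  | .dens, S, a => 0 < S.h a
  | .sure, S, a => S.SomeTypeBelow a

open Classical in
/-- The results of the three tests. -/
noncomputable def testResults (S : AuditSetting) (a : S.AgentType) (t : Test) : Bool :=
  decide (t.Holds S a)

theorem testResults_eq_true {S : AuditSetting} {a : S.AgentType} {t : Test} :
    testResults S a t = true ↔ t.Holds S a := by
  simp [testResults]

theorem testResults_eq_false {S : AuditSetting} {a : S.AgentType} {t : Test} :
    testResults S a t = false ↔ ¬ t.Holds S a := by
  simp [testResults]

theorem verdict_eq_comma_iff (S : AuditSetting) {n : ℕ} (i : Fin n) (a : S.AgentType)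
    (hmin : ∀ x, (∃ z, 0 < S.h (x, z)) → ∃ z, S.IsMinimumType x z) :
    verdict (testResults S a) = .comma ↔ S.IsSuspicious i a := by
  rw [S.isSuspicious_iff i a hmin]
  simp only [verdict, testResults_eq_true, testResults_eq_false, Test.Holds]
  split_ifs with h₁ h₂ <;>
    simp_all [testResults_eq_true, -Bool.not_eq_true, Test.Holds]

theorem verdict_eq_ket_iff (S : AuditSetting) (a : S.AgentType) :
    verdict (testResults S a) = .ket ↔ S.IsSureLie a := by
  have := S.h_nonneg a
  have hpos : S.IsSureLie a ↔ ¬ 0 < S.h a := by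
    rw [AuditSetting.IsSureLie, (S.h_nonneg a).lt_iff_ne', not_not]
  rw [hpos]
  simp only [verdict, testResults_eq_true, testResults_eq_false, Test.Holds]
  split_ifs with h₁ h₂ <;>
    simp_all [testResults_eq_true, -Bool.not_eq_true, Test.Holds]

theorem countSuspicious_ofFn (S : AuditSetting)
    (hmin : ∀ x, (∃ z, 0 < S.h (x, z)) → ∃ z, S.IsMinimumType x z) {n : ℕ}
    (A : Fin n → S.AgentType) (w : Fin n → List Bool × List Bool) :
    countSuspicious (List.ofFn fun i => (w i, testResults S (A i))) = (S.suspicious A).card := by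
  classical
  have : S.suspicious A =
      Finset.univ.filter fun i => verdict (testResults S (A i)) = .comma := by
    ext i
    simp [AuditSetting.suspicious, verdict_eq_comma_iff S i (A i) hmin]
  rw [this, countSuspicious, List.ofFn_eq_map, List.countP_map, Finset.card_def,
    Finset.filter_val, ← Multiset.countP_eq_card_filter, Fin.univ_def]
  simp [Function.comp_def]

/-- Cross-multiplication by `B.den * k`. The case `k = 0` must be excluded: there `B / 0` is 0 in
Lean, while `capped` gives 1. -/
theorem capped_div {B : ℚ≥0} {k : ℕ} (hk : k ≠ 0) :
    (capped B.num (B.den * k)).2 ≠ 0 ∧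
      ((capped B.num (B.den * k)).1 : ℝ) / ((capped B.num (B.den * k)).2 : ℝ) =
        min ((B : ℝ) / k) 1 := by
  have hden : (0 : ℝ) < B.den := by exact_mod_cast B.den_pos
  have hk' : (0 : ℝ) < k := by exact_mod_cast Nat.pos_of_ne_zero hk
  have hB : (B : ℝ) / k = B.num / (B.den * k) := by rw [NNRat.cast_def, div_div]
  rw [capped, hB]
  split_ifs with h
  · have : (B.den * k : ℝ) ≤ B.num := by exact_mod_cast h
    rw [min_eq_right ((one_le_div (by positivity)).2 this)]
    simp
  · have : (B.num : ℝ) ≤ B.den * k := by exact_mod_cast (not_le.1 h).le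
    rw [min_eq_left ((div_le_one (by positivity)).2 this)]
    exact ⟨Nat.mul_ne_zero B.den_pos.ne' hk, by push_cast; rfl⟩

theorem probability_eq_uniform (S : AuditSetting)
    (hmin : ∀ x, (∃ z, 0 < S.h (x, z)) → ∃ z, S.IsMinimumType x z) (B : ℚ≥0) {n : ℕ}
    (A : Fin n → S.AgentType) (i : Fin n) {q : ℕ × ℕ}
    (hq : q = probability (capped B.num (B.den * (S.suspicious A).card))
      (verdict (testResults S (A i)))) :
    q.2 ≠ 0 ∧ (q.1 : ℝ) / (q.2 : ℝ) = S.uniform (B : ℝ) A i := by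
  classical
  subst hq
  have hmem : i ∈ S.suspicious A ↔ S.IsSuspicious i (A i) := by simp [AuditSetting.suspicious]
  simp only [probability, verdict_eq_ket_iff, verdict_eq_comma_iff S i (A i) hmin,
    AuditSetting.uniform, hmem]
  split_ifs with h₁ h₂
  · simp
  -- Agent `i` is itself suspicious, so the count is not zero.
  · exact capped_div (Finset.card_ne_zero_of_mem (hmem.2 h₂))
  · simp

/-! ### The audit machine -/

/-- The stack machine that runs the audit program. -/
def auditMachine (T : Test → TM2ComputableAux Γ' Bool) : FinTM2 where
  K := Own ⊕ Σ t, (machines T t).K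
  kFin :=
    haveI := fun t => (machines T t).kFin
    inferInstance
  k₀ := .inl .inp
  k₁ := .inl .out
  Γ := alphabet Own Γ' (machines T)
  Λ := (audit (T := T)).Λ
  main := (audit (T := T)).entry
  σ := CallState Reg (machines T)
  initialState := ready _ {}
  σFin :=
    haveI := fun t => (machines T t).σFin
    inferInstance
  Γk₀Fin := inferInstanceAs (Fintype Γ')
  m := (audit (T := T)).code

theorem update_nil_eq_join {T : Test → TM2ComputableAux Γ' Bool} (i : Own) (x : List Γ') :
    Function.update (fun _ => [] : ∀ k, List (alphabet Own Γ' (machines T) k)) (.inl i) x =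
      join (Mem.set {} i x).get (idle (machines T)) := by
  have : (fun _ => [] : ∀ k, List (alphabet Own Γ' (machines T) k)) =
      join (Mem.get {}) (idle (machines T)) := by
    funext k
    rcases k with k | k
    · cases k <;> rfl
    · rfl
  rw [this, update_join_inl, Mem.update_get]

theorem auditMachine_outputs {T : Test → TM2ComputableAux Γ' Bool} {x y : List Γ'} {n : ℕ}
    (h : Leads (T := T) audit {} { inp := x } {} { out := y } n) :
    Nonempty (TM2OutputsInTime (auditMachine T) x (some y) n) := by
  obtain ⟨k, hk, hs⟩ := h
  have h₁ : (initList (auditMachine T) x).stk =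
      join (Mem.get { inp := x }) (idle (machines T)) :=
    (initList_stk (auditMachine T) x).trans (update_nil_eq_join .inp x)
  have h₂ : (haltList (auditMachine T) y).stk =
      join (Mem.get { out := y }) (idle (machines T)) :=
    (haltList_stk (auditMachine T) y).trans (update_nil_eq_join .out y)
  refine ⟨⟨⟨k, ?_⟩, hk⟩⟩
  rw [← h₁, ← h₂] at hs
  exact stepsTo_iff_iterate.1 hs

theorem length_digits (n : ℕ) : (digits n).length = (encodeNat n).length := List.length_map _

/-- Natural coefficients make evaluation monotone, so a time bound in the length of a query is also
one in the length of the whole input. -/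
theorem monotone_eval (p : Polynomial ℕ) : Monotone fun n => p.eval n := fun m n h => by
  simp only [Polynomial.eval_eq_sum]
  exact Finset.sum_le_sum fun i _ => Nat.mul_le_mul_left _ (Nat.pow_le_pow_left h i)

end StackMachine

/-! ### Assembling the machine and its time bound -/

open StackMachine

theorem mainTheorem6 (C : AuditClass)
    (hmin : ∀ (p : C.ι) (x : (C.setting p).X), (∃ z, 0 < (C.setting p).h (x, z)) →
      ∃ z, (C.setting p).IsMinimumType x z)
    (hscore : C.PolyTimeDecidable fun S a => S.θ ≤ S.f a)
    (hdens : C.PolyTimeDecidable fun S a => 0 < S.h a)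
    (hsure : C.PolyTimeDecidable fun S a => S.SomeTypeBelow a) :
    C.UniformPolyTimeComputable := by
  have hD : ∀ t : Test, Nonempty (TM2ComputableInPolyTime C.encodeQuery encodeBool
      fun q : C.Query => testResults (C.setting q.1) q.2.type t) := fun t =>
    match t with
    | .score => hscore
    | .dens => hdens
    | .sure => hsure
  let D := fun t => (hD t).some
  let T : Test → TM2ComputableAux Γ' Bool := fun t => (D t).toTM2ComputableAux
  -- The sum serves as a common time bound for the three tests.
  let τ : Polynomial ℕ := (D .score).time + (D .dens).time + (D .sure).time
  let card (I : C.Input) : ℕ := ((C.setting I.p).suspicious fun j => (I.report j).type).card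
  let g (I : C.Input) : List (ℕ × ℕ) := List.ofFn fun i =>
    probability (capped I.B.num (I.B.den * card I))
      (verdict (testResults (C.setting I.p) (I.report i).type))
  -- The bound of `audit_leads` with `s = 2 * L` and at most `L` reports, where `L` is the input
  -- length.
  let time : Polynomial ℕ := .X * (44 * .X + 3 * τ + 48) + 36 * .X + 20
  refine ⟨g, ⟨⟨⟨auditMachine T, Equiv.refl Γ', Equiv.refl Γ'⟩, time, fun I => ?_⟩⟩, fun I => ?_⟩
  · apply Classical.choice
    set L := (C.encodeInput I).length with hL
    let l := List.ofFn fun i =>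
      ((I.report i).1, testResults (C.setting I.p) (I.report i).type)
    have hlen : l.length = I.n := List.length_ofFn
    have hinput : C.encodeInput I = (C.desc I.p).map Γ'.bit ++
        Γ'.comma :: (encodeFraction (I.B.num, I.B.den) ++ l.flatMap fun x => encodePair x.1) := by
      simp only [AuditClass.encodeInput, l, List.ofFn_eq_map, List.flatMap_map]
    have hlength : L = (C.desc I.p).length + 1 + (digits I.B.num).length +
        (digits I.B.den).length + 3 + (l.flatMap fun x => encodePair x.1).length := by
      rw [hL, hinput]
      simp only [encodeFraction, encodePair, digits, List.length_append, List.length_cons,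
        List.length_map, List.length_nil]
      omega
    have hpairs : ∀ x ∈ l, (encodePair x.1).length ≤
        (l.flatMap fun x => encodePair x.1).length := fun x hx => by
      rw [List.length_flatMap]
      exact List.single_le_sum (fun _ _ => Nat.zero_le _) _ (List.mem_map_of_mem hx)
    -- Every encoded report contributes at least one symbol.
    have hn : I.n ≤ (l.flatMap fun x => encodePair x.1).length := by
      rw [List.length_flatMap, ← hlen, ← List.length_map (fun x => (encodePair x.1).length)]
      refine List.length_le_sum_of_one_le _ fun k hk => ?_
      obtain ⟨x, -, rfl⟩ := List.mem_map.1 hk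
      simp [encodePair]
    have hans : ∀ x ∈ l, Answers T (C.desc I.p) x.1 x.2 (τ.eval L) := fun x hx t => by
      obtain ⟨i, rfl⟩ := List.mem_ofFn.1 hx
      have hq : (encodePair (I.report i).1).length ≤ _ := hpairs _ hx
      have h := (D t).outputsFun ⟨I.p, I.report i⟩
      refine ⟨⟨h.toEvalsTo, h.steps_le_m.trans ?_⟩⟩
      -- The setting, a comma and one encoded report all occur in the input.
      have hle : (C.encodeQuery ⟨I.p, I.report i⟩).length ≤ L := by
        simp only [AuditClass.encodeQuery, List.length_append, List.length_map, List.length_cons]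
        omega
      refine (monotone_eval (D t).time hle).trans ?_
      simp only [τ, Polynomial.eval_add]
      cases t <;> omega
    -- `den` has at most `L` digits, and multiplying by `i ≤ n ≤ L` adds at most `L` more; hence the
    -- choice `s = 2 * L`.
    have hdig : ∀ i ≤ l.length, (digits (I.B.den * i)).length ≤ 2 * L := fun i hi => by
      have := length_encodeNat_mul_le I.B.den i
      rw [← length_digits, ← length_digits] at this
      omega
    have h := audit_leads (T := T) l hans I.B.num I.B.den (2 * L) (by omega) (by omega)
      (fun x hx => (hpairs x hx).trans (by omega)) (by omega) (by omega) hdig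
    have hcard : countSuspicious l = card I := countSuspicious_ofFn _ (hmin I.p) _ _
    rw [← hinput, hcard] at h
    have hout : (l.map fun x => probability (capped I.B.num (I.B.den * card I)) (verdict x.2)) =
        g I := by
      simp only [l, g, List.map_ofFn, Function.comp_def]
    rw [hout] at h
    have hle : l.length * (22 * (2 * L) + 3 * τ.eval L + 48) + 18 * (2 * L) + 20 ≤
        time.eval L := by
      have : l.length * (22 * (2 * L) + 3 * τ.eval L + 48) ≤
          L * (44 * L + 3 * τ.eval L + 48) :=
        Nat.mul_le_mul (by omega) (by omega)
      simp only [time, Polynomial.eval_add, Polynomial.eval_mul, Polynomial.eval_X,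
        Polynomial.eval_ofNat]
      omega
    have := auditMachine_outputs (Fragment.Runs.mono h hle)
    have hmap : ∀ x : List Γ', x.map (Equiv.refl Γ').invFun = x := List.map_id
    rw [← hmap (C.encodeInput I), ← hmap (encodeFractions (g I))] at this
    exact this
  · refine ⟨List.length_ofFn, fun i => ?_⟩
    refine probability_eq_uniform _ (hmin I.p) I.B (fun j => (I.report j).type) i ?_
    simp [g, card]
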